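/- Let $G$ be a compactly generated, totally disconnected, locally compact group. A \emph{Cayley--Abels graph} for $G$ is a connected, locally finite graph (without loops or multiple edges) on which $G$ acts by automorphisms, transitively on the vertices, such that all vertex stabilizers are compact open subgroups of $G$. Let $\mathrm{md}(G)$ denote the minimal degree of a Cayley--Abels graph for $G$. A \emph{ray} in a graph is a one-way infinite path with pairwise different vertices, and the \emph{ends} of a graph are the equivalence classes of rays, where two rays are equivalent if some ray meets both of them in infinitely many vertices. The following conditions are equivalent. \begin{enumerate} \item $\mathrm{md}(G)=2$. \item $G$ has precisely two ends, that is, some (equivalently, every) Cayley--Abels graph for $G$ has precisely two ends. \item There is a continuous surjective homomorphism with compact open kernel from $G$ onto the infinite cyclic group $\mathbb{Z}$ or onto the infinite dihedral group $D_\infty$ (both with the discrete topology). \item $G$ has a co-compact, discrete, infinite cyclic subgroup. \end{enumerate} -/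

import Mathlib

open scoped Topology

universe u v

/-- A topological group is compactly generated if it is generated, as an abstract group, by a
compact subset. -/
def IsCompactlyGeneratedGroup (G : Type u) [Group G] [TopologicalSpace G] : Prop :=
  ∃ S : Set G, IsCompact S ∧ Subgroup.closure S = ⊤

/-- `Γ`, with the given action of `G` on its vertices, is a Cayley–Abels graph for `G`: a connected,
locally finite graph on which `G` acts by automorphisms, transitively on the vertices, and with
compact open vertex stabilizers. -/
structure IsCayleyAbelsGraph (G : Type u) [Group G] [TopologicalSpace G] {V : Type v}
    [MulAction G V] (Γ : SimpleGraph V) : Prop where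
  connected : Γ.Connected
  locallyFinite : ∀ x : V, (Γ.neighborSet x).Finite
  smul_adj : ∀ (g : G) (x y : V), Γ.Adj (g • x) (g • y) ↔ Γ.Adj x y
  transitive : ∀ x y : V, ∃ g : G, g • x = y
  isOpen_stabilizer : ∀ x : V, IsOpen (MulAction.stabilizer G x : Set G)
  isCompact_stabilizer : ∀ x : V, IsCompact (MulAction.stabilizer G x : Set G)

/-- The degrees of the Cayley–Abels graphs for `G`. Every such graph is isomorphic, as a graph with
`G`-action, to one on a coset space `G ⧸ U`, so vertex sets in the universe of `G` suffice. -/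
def cayleyAbelsDegrees (G : Type u) [Group G] [TopologicalSpace G] : Set ℕ :=
  {d | ∃ (V : Type u) (_ : MulAction G V) (Γ : SimpleGraph V),
    IsCayleyAbelsGraph G Γ ∧ ∀ x : V, (Γ.neighborSet x).ncard = d}

/-- The minimal degree `md(G)` of a Cayley–Abels graph for `G`. (The value is `0` if there is no
such graph, which does not happen for compactly generated, totally disconnected, locally compact
groups.) -/
noncomputable def minimalDegree (G : Type u) [Group G] [TopologicalSpace G] : ℕ :=
  sInf (cayleyAbelsDegrees G)

/-- A ray in a graph: a one-way infinite path all of whose vertices are different. -/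
structure GraphRay {V : Type v} (Γ : SimpleGraph V) where
  vertex : ℕ → V
  adj : ∀ i : ℕ, Γ.Adj (vertex i) (vertex (i + 1))
  injective : Function.Injective vertex

/-- Two rays are equivalent if some ray meets both of them in infinitely many vertices. -/
def GraphRay.Equivalent {V : Type v} {Γ : SimpleGraph V} (α β : GraphRay Γ) : Prop :=
  ∃ γ : GraphRay Γ, (Set.range γ.vertex ∩ Set.range α.vertex).Infinite ∧
    (Set.range γ.vertex ∩ Set.range β.vertex).Infinite

/-- The ends of a graph: the equivalence classes of rays. (Equivalence of rays is an equivalence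
relation, so that passing to the equivalence relation that it generates, as `Quot` does, changes
nothing.) -/
def GraphEnd {V : Type v} (Γ : SimpleGraph V) : Type v :=
  Quot (GraphRay.Equivalent (Γ := Γ))

/-- There is a continuous surjective homomorphism with compact open kernel from `G` onto the group
`Q`, where `Q` carries the discrete topology. -/
def SurjectsWithCompactOpenKernel (G : Type u) [Group G] [TopologicalSpace G]
    (Q : Type v) [Group Q] : Prop :=
  ∃ f : G →* Q, Continuous[_, ⊥] f ∧ Function.Surjective f ∧
    IsCompact (f.ker : Set G) ∧ IsOpen (f.ker : Set G)

/-- `G` has a co-compact, discrete, infinite cyclic subgroup. -/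
def HasCocompactDiscreteInfiniteCyclicSubgroup (G : Type u) [Group G] [TopologicalSpace G] :
    Prop :=
  ∃ H : Subgroup G, IsCyclic H ∧ Infinite H ∧ DiscreteTopology H ∧ CompactSpace (G ⧸ H)

namespace SimpleGraph

variable {V : Type v} {Γ : SimpleGraph V}

/-- The vertices that are incident to an edge joining `D` to its complement. -/
def edgeBoundaryVertices (Γ : SimpleGraph V) (D : Set V) : Set V :=
  {x | ∃ y, Γ.Adj x y ∧ ¬ (x ∈ D ↔ y ∈ D)}

/-- The vertices that can be reached from `x` by a walk inside `A`. -/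
def reachableWithin (Γ : SimpleGraph V) (A : Set V) (x : V) : Set V :=
  {y | ∃ p : Γ.Walk x y, ∀ z ∈ p.support, z ∈ A}

/-- There is an infinite, coinfinite set with finite boundary, and every set with finite boundary
agrees up to finitely many vertices with it, its complement, the empty set or everything. -/
def IsTwoEnded (Γ : SimpleGraph V) : Prop :=
  ∃ C : Set V, (Γ.edgeBoundaryVertices C).Finite ∧ C.Infinite ∧ Cᶜ.Infinite ∧
    ∀ D : Set V, (Γ.edgeBoundaryVertices D).Finite →
      ((C ∩ D).Finite ∨ (C ∩ Dᶜ).Finite) ∧ ((Cᶜ ∩ D).Finite ∨ (Cᶜ ∩ Dᶜ).Finite)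

theorem edgeBoundaryVertices_compl (D : Set V) :
    Γ.edgeBoundaryVertices Dᶜ = Γ.edgeBoundaryVertices D := by
  ext x
  simp only [edgeBoundaryVertices, Set.mem_ofPred_eq, Set.mem_compl_iff, not_iff_not]

theorem edgeBoundaryVertices_inter_subset (C D : Set V) :
    Γ.edgeBoundaryVertices (C ∩ D) ⊆ Γ.edgeBoundaryVertices C ∪ Γ.edgeBoundaryVertices D := by
  rintro x ⟨y, hxy, h⟩
  by_cases hC : x ∈ C ↔ y ∈ C
  · right
    refine ⟨y, hxy, fun hD => h ?_⟩
    simp [hC, hD]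
  · exact Or.inl ⟨y, hxy, hC⟩

theorem finite_edgeBoundaryVertices_inter {C D : Set V} (hC : (Γ.edgeBoundaryVertices C).Finite)
    (hD : (Γ.edgeBoundaryVertices D).Finite) : (Γ.edgeBoundaryVertices (C ∩ D)).Finite :=
  (hC.union hD).subset (edgeBoundaryVertices_inter_subset C D)

theorem exists_ray_of_extend (P : List V → Prop) (A B : Set V) (L₀ : List V) (h₀ : P L₀)
    (hP : ∀ L, P L → L.IsChain Γ.Adj ∧ L.Nodup)
    (hext : ∀ L, P L → ∃ L', P L' ∧ L <+: L' ∧ (∃ x ∈ L', x ∉ L ∧ x ∈ A) ∧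
      (∃ x ∈ L', x ∉ L ∧ x ∈ B)) :
    ∃ γ : GraphRay Γ, (∀ i, ∃ L, P L ∧ γ.vertex i ∈ L) ∧ (Set.range γ.vertex ∩ A).Infinite ∧
      (Set.range γ.vertex ∩ B).Infinite := by
  choose! F hFP hFpre hFA hFB using hext
  let S : ℕ → List V := fun n => F^[n] L₀
  have hS : ∀ n, S (n + 1) = F (S n) := fun n => Function.iterate_succ_apply' F n L₀
  have hSP : ∀ n, P (S n) := by
    intro n
    induction n with
    | zero => exact h₀
    | succ n ih => rw [hS]; exact hFP _ ih
  have hpre : ∀ m n, m ≤ n → S m <+: S n := by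
    intro m n hmn
    induction n, hmn using Nat.le_induction with
    | base => exact List.prefix_refl _
    | succ n _ ih => rw [hS]; exact ih.trans (hFpre _ (hSP n))
  have hlen : ∀ n, n ≤ (S n).length := by
    intro n
    induction n with
    | zero => exact Nat.zero_le _
    | succ n ih =>
      obtain ⟨x, hx, hx', -⟩ := hFA _ (hSP n)
      obtain ⟨T, hT⟩ := hFpre _ (hSP n)
      rw [hS, ← hT, List.length_append]
      have : T ≠ [] := by
        rintro rfl
        rw [← hT] at hx
        simp at hx
        exact hx' hx
      have := List.length_pos_of_ne_nil this
      omega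
  have hlt : ∀ n, n < (S (n + 1)).length := fun n => hlen (n + 1)
  let w : ℕ → V := fun n => (S (n + 1))[n]'(hlt n)
  have hw : ∀ m n (h : n < (S m).length), (S m)[n] = w n := by
    intro m n h
    rcases le_total m (n + 1) with h' | h'
    · exact (hpre _ _ h').getElem h
    · exact ((hpre _ _ h').getElem (hlt n)).symm
  have hrange : ∀ m, ∀ x ∈ S m, x ∈ Set.range w := by
    intro m x hx
    obtain ⟨n, hn, rfl⟩ := List.getElem_of_mem hx
    exact ⟨n, (hw m n hn).symm⟩
  have hinf : ∀ E : Set V, (∀ L, P L → ∃ x ∈ F L, x ∉ L ∧ x ∈ E) →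
      (Set.range w ∩ E).Infinite := by
    intro E hE
    choose x hx hx' hxE using fun n => hE (S n) (hSP n)
    have key : ∀ m n, m < n → x m ≠ x n := by
      intro m n hmn h
      refine hx' n (h ▸ (hpre (m + 1) n hmn).subset ?_)
      rw [hS]
      exact hx m
    refine Set.infinite_of_injective_forall_mem (f := x) (fun m n hmn => ?_)
      (fun n => ⟨hrange (n + 1) _ (hS n ▸ hx n), hxE n⟩)
    rcases lt_trichotomy m n with h | h | h
    · exact absurd hmn (key _ _ h)
    · exact h
    · exact absurd hmn.symm (key _ _ h)
  refine ⟨⟨w, fun i => ?_, fun i j hij => ?_⟩, fun i => ⟨S (i + 1), hSP _, ?_⟩, ?_, ?_⟩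
  · have h := List.isChain_iff_getElem.1 (hP _ (hSP (i + 2))).1 i (hlt (i + 1))
    rwa [hw, hw] at h
  · have h := (hP _ (hSP (i + j + 1))).2
    have hl := hlen (i + j + 1)
    rw [← hw (i + j + 1) i (by omega), ← hw (i + j + 1) j (by omega)] at hij
    exact (List.Nodup.getElem_inj_iff h).1 hij
  · exact List.getElem_mem _
  · exact hinf A hFA
  · exact hinf B hFB

theorem exists_infinite_reachableWithin (hΓ : Γ.Connected) {D : Set V} (hD : D.Infinite)
    (hb : (Γ.edgeBoundaryVertices D).Finite) : ∃ x ∈ D, (Γ.reachableWithin D x).Infinite := by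
  obtain ⟨x₀, hx₀⟩ := hD.nonempty
  have key : ∀ y z, Γ.Walk y z → z = x₀ → y ∈ D →
      ∃ b ∈ insert x₀ (Γ.edgeBoundaryVertices D), y ∈ Γ.reachableWithin D b := by
    intro y z p
    induction p with
    | nil =>
      rintro rfl hy
      exact ⟨_, Set.mem_insert _ _, Walk.nil, by simpa using hy⟩
    | @cons a b c hab p ih =>
      intro hc ha
      by_cases hbD : b ∈ D
      · obtain ⟨e, he, q, hq⟩ := ih hc hbD
        refine ⟨e, he, q.concat hab.symm, fun z hz => ?_⟩
        rw [Walk.support_concat, List.mem_append] at hz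
        rcases hz with hz | hz
        · exact hq z hz
        · rw [List.mem_singleton.1 hz]; exact ha
      · refine ⟨a, Set.mem_insert_of_mem _ ⟨b, hab, by tauto⟩, Walk.nil, by simpa using ha⟩
  by_contra! hcon
  refine hD (((hb.insert x₀).biUnion (t := fun b => Γ.reachableWithin D b) fun b _ => ?_).subset
    fun y hy => ?_)
  · by_cases hbD : b ∈ D
    · exact hcon b hbD
    · convert Set.finite_empty
      ext y
      simp only [reachableWithin, Set.mem_ofPred_eq, Set.mem_empty_iff_false, iff_false]
      rintro ⟨p, hp⟩
      exact hbD (hp _ p.start_mem_support)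
  · obtain ⟨p⟩ := hΓ.preconnected y x₀
    obtain ⟨b, hb, hy⟩ := key y x₀ p rfl hy
    exact Set.mem_biUnion hb hy

/-- A form of Kőnig's lemma. -/
theorem exists_ray_subset (hΓ : Γ.Connected) (hfin : ∀ x, (Γ.neighborSet x).Finite) {D : Set V}
    (hD : D.Infinite) (hb : (Γ.edgeBoundaryVertices D).Finite) :
    ∃ γ : GraphRay Γ, ∀ i, γ.vertex i ∈ D := by
  classical
  obtain ⟨x₀, hx₀, hinf⟩ := exists_infinite_reachableWithin hΓ hD hb
  let P : List V → Prop := fun L => L.IsChain Γ.Adj ∧ L.Nodup ∧ (∀ x ∈ L, x ∈ D) ∧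
    ∃ x, L.getLast? = some x ∧ (Γ.reachableWithin {z | z ∈ D ∧ (z ∉ L ∨ z = x)} x).Infinite
  have hstart : P [x₀] := by
    refine ⟨by simp, by simp, by simpa using hx₀, x₀, rfl, ?_⟩
    convert hinf using 2
    ext z
    simp only [List.mem_singleton, Set.mem_ofPred_eq]
    tauto
  suffices hstep : ∀ L, P L → ∃ L', P L' ∧ L <+: L' ∧ (∃ x ∈ L', x ∉ L ∧ x ∈ Set.univ) ∧
      (∃ x ∈ L', x ∉ L ∧ x ∈ Set.univ) by
    obtain ⟨γ, hγ, -, -⟩ := exists_ray_of_extend (Γ := Γ) P Set.univ Set.univ [x₀] hstart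
      (fun L h => ⟨h.1, h.2.1⟩) hstep
    refine ⟨γ, fun i => ?_⟩
    obtain ⟨L, hL, hi⟩ := hγ i
    exact hL.2.2.1 _ hi
  rintro L ⟨hc, hn, hLD, x, hx, hR⟩
  set A : Set V := {z | z ∈ D ∧ (z ∉ L ∨ z = x)}
  have hsub : Γ.reachableWithin A x ⊆
      insert x (⋃ y ∈ Γ.neighborSet x, Γ.reachableWithin (A \ {x}) y) := by
    rintro y ⟨p, hp⟩
    have hp' : ∀ z ∈ p.bypass.support, z ∈ A := fun z hz =>
      hp z (p.support_bypass_subset_support hz)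
    have hpath := p.bypass_isPath
    generalize p.bypass = q at hp' hpath
    cases q with
    | nil => exact Set.mem_insert _ _
    | @cons _ b _ hab q =>
      rw [Walk.cons_isPath_iff] at hpath
      refine Set.mem_insert_of_mem _ (Set.mem_biUnion (show b ∈ Γ.neighborSet x from hab)
        ⟨q, fun z hz => ⟨hp' z (by simp [hz]), ?_⟩⟩)
      rintro rfl
      exact hpath.2 hz
  obtain ⟨y, hxy, hy⟩ : ∃ y ∈ Γ.neighborSet x, (Γ.reachableWithin (A \ {x}) y).Infinite := by
    by_contra! hcon
    exact hR ((((hfin x).biUnion fun y hy => hcon y hy).insert x).subset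
      hsub)
  have hyA : y ∈ A \ {x} := by
    obtain ⟨z, p, hp⟩ := hy.nonempty
    exact hp y p.start_mem_support
  have hyL : y ∉ L := hyA.1.2.resolve_right hyA.2
  refine ⟨L ++ [y], ⟨?_, ?_, ?_, y, by simp, hy.mono ?_⟩, List.prefix_append _ _,
    ⟨y, by simp, hyL, trivial⟩, ⟨y, by simp, hyL, trivial⟩⟩
  · refine List.isChain_append.2 ⟨hc, by simp, fun a ha b hb => ?_⟩
    simp only [List.head?_cons, Option.mem_def, Option.some.injEq] at ha hb
    rw [hx] at ha
    cases ha
    cases hb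
    exact hxy
  · refine List.nodup_append.2 ⟨hn, by simp, fun a ha b hb => ?_⟩
    rw [List.mem_singleton.1 hb]
    rintro rfl
    exact hyL ha
  · intro z hz
    rcases List.mem_append.1 hz with hz | hz
    · exact hLD z hz
    · rw [List.mem_singleton.1 hz]; exact hyA.1.1
  · rintro z ⟨p, hp⟩
    refine ⟨p, fun a ha => ?_⟩
    obtain ⟨⟨haD, haL⟩, hax⟩ := hp a ha
    refine ⟨haD, ?_⟩
    by_cases hay : a = y
    · exact Or.inr hay
    · left
      simp only [List.mem_append, List.mem_singleton, not_or]
      exact ⟨haL.resolve_right hax, hay⟩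

end SimpleGraph

namespace SimpleGraph

variable {V : Type v} {Γ : SimpleGraph V}

/-- `L` is a finite path that ends on the ray `α` and avoids all later vertices of `α`. -/
def EndsOnRay (α : GraphRay Γ) (L : List V) : Prop :=
  L.IsChain Γ.Adj ∧ L.Nodup ∧ ∃ i, L.getLast? = some (α.vertex i) ∧ ∀ k, i < k → α.vertex k ∉ L

theorem exists_endsOnRay_extend_along (α : GraphRay Γ) {L : List V} {i : ℕ}
    (hc : L.IsChain Γ.Adj) (hn : L.Nodup) (hi : L.getLast? = some (α.vertex i))
    (hL : ∀ k, i < k → α.vertex k ∉ L) (m : ℕ) :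
    ∃ L', L <+: L' ∧ L'.IsChain Γ.Adj ∧ L'.Nodup ∧ L'.getLast? = some (α.vertex (i + m)) ∧
      (∀ k, i + m < k → α.vertex k ∉ L') ∧ ∀ x ∈ L', x ∈ L ∨ x ∈ Set.range α.vertex := by
  induction m with
  | zero => exact ⟨L, List.prefix_refl _, hc, hn, hi, hL, fun x hx => Or.inl hx⟩
  | succ m ih =>
    obtain ⟨L', hpre, hc', hn', hi', hL', hsub⟩ := ih
    refine ⟨L' ++ [α.vertex (i + m + 1)], hpre.trans (List.prefix_append _ _), ?_, ?_, ?_, ?_, ?_⟩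
    · refine List.isChain_append.2 ⟨hc', by simp, fun a ha b hb => ?_⟩
      simp only [List.head?_cons, Option.mem_def, Option.some.injEq] at ha hb
      rw [hi'] at ha
      cases ha
      cases hb
      exact α.adj _
    · refine List.nodup_append.2 ⟨hn', by simp, fun a ha b hb => ?_⟩
      rw [List.mem_singleton.1 hb]
      rintro rfl
      exact hL' _ (by omega) ha
    · simp [add_assoc]
    · intro k hk hmem
      rcases List.mem_append.1 hmem with h | h
      · exact hL' k (by omega) h
      · have := α.injective (List.mem_singleton.1 h)
        omega
    · intro x hx
      rcases List.mem_append.1 hx with h | h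
      · exact hsub x h
      · exact Or.inr ⟨_, (List.mem_singleton.1 h).symm⟩

theorem exists_isPath_between_rays (α β : GraphRay Γ) {S : Set V}
    (h : ∃ k l, ∃ p : Γ.Walk (α.vertex k) (β.vertex l), ∀ z ∈ p.support, z ∉ S) :
    ∃ k l, ∃ p : Γ.Walk (α.vertex k) (β.vertex l), p.IsPath ∧ (∀ z ∈ p.support, z ∉ S) ∧
      (∀ z ∈ p.support, z ∈ Set.range α.vertex → z = α.vertex k) ∧
      (∀ z ∈ p.support, z ∈ Set.range β.vertex → z = β.vertex l) := by
  classical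
  have h' : ∃ n k l, ∃ p : Γ.Walk (α.vertex k) (β.vertex l),
      p.length = n ∧ ∀ z ∈ p.support, z ∉ S := by
    obtain ⟨k, l, p, hp⟩ := h
    exact ⟨_, k, l, p, rfl, hp⟩
  obtain ⟨k, l, p₀, hlen₀, hp₀⟩ := Nat.find_spec h'
  have hmin : ∀ k' l' (q : Γ.Walk (α.vertex k') (β.vertex l')), (∀ z ∈ q.support, z ∉ S) →
      Nat.find h' ≤ q.length := fun k' l' q hq => Nat.find_min' h' ⟨k', l', q, rfl, hq⟩
  have hp : ∀ z ∈ p₀.bypass.support, z ∉ S := fun z hz =>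
    hp₀ z (p₀.support_bypass_subset_support hz)
  have hlen : p₀.bypass.length ≤ Nat.find h' := hlen₀ ▸ p₀.length_bypass_le_length
  have hpath := p₀.bypass_isPath
  generalize p₀.bypass = p at hp hlen hpath
  refine ⟨k, l, p, hpath, hp, ?_, ?_⟩
  · rintro z hz ⟨k', rfl⟩
    by_contra hne
    have h1 := hmin k' l (p.dropUntil _ hz) fun z' hz' =>
      hp z' (p.support_dropUntil_subset_support hz hz')
    have h2 := p.length_dropUntil_lt_length hz hne
    omega
  · rintro z hz ⟨l', rfl⟩
    by_contra hne
    have h1 := hmin k l' (p.takeUntil _ hz) fun z' hz' =>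
      hp z' (p.support_takeUntil_subset_support hz hz')
    have h2 := p.length_takeUntil_lt_length hz hne
    omega

theorem exists_index_forall_gt_vertex_notMem (β : GraphRay Γ) {S : Set V} (hS : S.Finite) :
    ∃ N, ∀ i, N < i → β.vertex i ∉ S := by
  obtain ⟨N, hN⟩ := (hS.preimage β.injective.injOn).bddAbove
  exact ⟨N, fun i hi hmem => absurd (hN hmem) (by omega)⟩

theorem EndsOnRay.exists_extend {α β : GraphRay Γ}
    (hdisj : Disjoint (Set.range α.vertex) (Set.range β.vertex))
    (hconn : ∀ S : Set V, S.Finite → ∃ k l, ∃ p : Γ.Walk (α.vertex k) (β.vertex l),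
      ∀ z ∈ p.support, z ∉ S) {L : List V} (hL : EndsOnRay α L) :
    ∃ L', EndsOnRay β L' ∧ L <+: L' ∧ ∃ x ∈ L', x ∉ L ∧ x ∈ Set.range β.vertex := by
  obtain ⟨hc, hn, i, hi, hiL⟩ := hL
  obtain ⟨j, hj⟩ := exists_index_forall_gt_vertex_notMem β (S := {x | x ∈ L}) L.finite_toSet
  have hαβ : ∀ a b, α.vertex a ≠ β.vertex b := fun a b hab =>
    Set.disjoint_left.1 hdisj ⟨a, rfl⟩ ⟨b, hab.symm⟩
  obtain ⟨k, l, p, hpath, hpS, hpα, hpβ⟩ := exists_isPath_between_rays α β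
    (hconn ({x | x ∈ L} ∪ (α.vertex '' Set.Iic i ∪ β.vertex '' Set.Iic j))
      ((L.finite_toSet).union (((Set.finite_Iic i).image _).union ((Set.finite_Iic j).image _))))
  have hik : i < k := by
    by_contra! hk
    exact hpS _ p.start_mem_support (Or.inr (Or.inl ⟨k, hk, rfl⟩))
  have hjl : j < l := by
    by_contra! hl
    exact hpS _ p.end_mem_support (Or.inr (Or.inr ⟨l, hl, rfl⟩))
  obtain ⟨L', hpre, hc', hn', hi', -, hsub⟩ :=
    exists_endsOnRay_extend_along α hc hn hi hiL (k - i)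
  rw [show i + (k - i) = k by omega] at hi'
  have hsupp := p.cons_tail_support
  have hpchain := p.isChain_adj_support
  have hpnodup := hpath.support_nodup
  have hlast : p.support.tail.getLast? = some (β.vertex l) := by
    have h1 : p.support.getLast? = some (β.vertex l) := by
      rw [List.getLast?_eq_some_getLast p.support_ne_nil, p.getLast_support]
    rw [← hsupp] at h1
    cases h2 : p.support.tail with
    | nil =>
      rw [h2] at h1
      simp only [List.getLast?_singleton, Option.some.injEq] at h1
      exact absurd h1 (hαβ _ _)
    | cons a t => rwa [h2, List.getLast?_cons_cons] at h1
  have htail : ∀ z ∈ p.support.tail, z ∈ p.support ∧ z ∉ Set.range α.vertex := by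
    intro z hz
    have hz' := List.mem_of_mem_tail hz
    refine ⟨hz', fun hzα => ?_⟩
    have := hpα z hz' hzα
    rw [← hsupp, List.nodup_cons] at hpnodup
    exact hpnodup.1 (this ▸ hz)
  have hmemL' : ∀ b, j < b → β.vertex b ∉ L' := by
    intro b hb hmem
    rcases hsub _ hmem with h | ⟨a, ha⟩
    · exact hj b hb h
    · exact hαβ a b ha
  refine ⟨L' ++ p.support.tail, ⟨?_, ?_, l, ?_, ?_⟩, hpre.trans (List.prefix_append _ _),
    β.vertex l, List.mem_append_right _ (List.mem_of_getLast? hlast), hj l hjl, l, rfl⟩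
  · rw [← hsupp] at hpchain
    refine List.isChain_append.2 ⟨hc', hpchain.tail, fun a ha b hb => ?_⟩
    rw [hi'] at ha
    cases ha
    exact (List.isChain_cons.1 hpchain).1 b hb
  · refine List.nodup_append.2 ⟨hn', hpnodup.tail, fun a ha b hb hab => ?_⟩
    subst hab
    obtain ⟨h1, h2⟩ := htail a hb
    rcases hsub a ha with h | h
    · exact hpS a h1 (Or.inl h)
    · exact h2 h
  · rw [List.getLast?_append, hlast]
    rfl
  · intro b hb hmem
    rcases List.mem_append.1 hmem with h | h
    · exact hmemL' b (by omega) h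
    · have := β.injective (hpβ _ (htail _ h).1 ⟨b, rfl⟩)
      omega

theorem equivalent_of_forall_exists_walk {α β : GraphRay Γ}
    (hdisj : Disjoint (Set.range α.vertex) (Set.range β.vertex))
    (hconn : ∀ S : Set V, S.Finite → ∃ k l, ∃ p : Γ.Walk (α.vertex k) (β.vertex l),
      ∀ z ∈ p.support, z ∉ S) : α.Equivalent β := by
  have hconn' : ∀ S : Set V, S.Finite → ∃ k l, ∃ p : Γ.Walk (β.vertex k) (α.vertex l),
      ∀ z ∈ p.support, z ∉ S := by
    intro S hS
    obtain ⟨k, l, p, hp⟩ := hconn S hS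
    exact ⟨l, k, p.reverse, by simpa using hp⟩
  have hstart : EndsOnRay α [α.vertex 0] := by
    refine ⟨by simp, by simp, 0, rfl, fun k hk hmem => ?_⟩
    have := α.injective (List.mem_singleton.1 hmem)
    omega
  obtain ⟨γ, -, hα, hβ⟩ := exists_ray_of_extend (EndsOnRay α) (Set.range α.vertex)
    (Set.range β.vertex) _ hstart (fun L h => ⟨h.1, h.2.1⟩) (by
      intro L hL
      obtain ⟨L₁, hL₁, hpre₁, x, hx, hxL, hxβ⟩ := hL.exists_extend hdisj hconn
      obtain ⟨L₂, hL₂, hpre₂, y, hy, hyL, hyα⟩ := hL₁.exists_extend hdisj.symm hconn'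
      exact ⟨L₂, hL₂, hpre₁.trans hpre₂, ⟨y, hy, fun h => hyL (hpre₁.subset h), hyα⟩,
        ⟨x, hpre₂.subset hx, hxL, hxβ⟩⟩)
  exact ⟨γ, hα, hβ⟩

/-- Inequivalent rays are separated by a set with finite boundary. -/
theorem exists_separating_of_not_equivalent (hfin : ∀ x, (Γ.neighborSet x).Finite)
    {α β : GraphRay Γ} (h : ¬ α.Equivalent β) :
    ∃ E : Set V, (Γ.edgeBoundaryVertices E).Finite ∧ (∀ᶠ i in Filter.atTop, α.vertex i ∈ E) ∧
      ∀ i, β.vertex i ∉ E := by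
  have hint : (Set.range α.vertex ∩ Set.range β.vertex).Finite := by
    by_contra hinf
    exact h ⟨α, by rw [Set.inter_self]; exact Set.infinite_range_of_injective α.injective, hinf⟩
  obtain ⟨N, hN⟩ := exists_index_forall_gt_vertex_notMem α hint
  let α' : GraphRay Γ := ⟨fun i => α.vertex (i + (N + 1)), fun i => by
    have := α.adj (i + (N + 1))
    rwa [show i + 1 + (N + 1) = i + (N + 1) + 1 by omega], fun i j hij => by
    have := α.injective hij
    omega⟩
  have hsub : Set.range α'.vertex ⊆ Set.range α.vertex := by
    rintro _ ⟨i, rfl⟩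
    exact ⟨_, rfl⟩
  have hdisj : Disjoint (Set.range α'.vertex) (Set.range β.vertex) := by
    rw [Set.disjoint_left]
    rintro _ ⟨i, rfl⟩ hβ
    exact hN (i + (N + 1)) (by omega) ⟨⟨_, rfl⟩, hβ⟩
  have h' : ¬ α'.Equivalent β := by
    rintro ⟨γ, h1, h2⟩
    exact h ⟨γ, h1.mono (Set.inter_subset_inter_right _ hsub), h2⟩
  obtain ⟨S, hS, hsep⟩ : ∃ S : Set V, S.Finite ∧ ∀ k l, ∀ p : Γ.Walk (α'.vertex k) (β.vertex l),
      ∃ z ∈ p.support, z ∈ S := by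
    by_contra! hcon
    exact h' (equivalent_of_forall_exists_walk hdisj hcon)
  set E : Set V := {x | ∃ k, ∃ p : Γ.Walk (α'.vertex k) x, ∀ z ∈ p.support, z ∉ S} with hE
  have hstep : ∀ x y, x ∈ E → y ∉ E → Γ.Adj x y → y ∈ S := by
    rintro x y ⟨k, p, hp⟩ hy hxy
    by_contra hyS
    refine hy ⟨k, p.concat hxy, fun z hz => ?_⟩
    rw [Walk.support_concat, List.mem_append] at hz
    rcases hz with hz | hz
    · exact hp z hz
    · rwa [List.mem_singleton.1 hz]
  refine ⟨E, (hS.union (hS.biUnion fun x _ => hfin x)).subset ?_, ?_, ?_⟩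
  · rintro x ⟨y, hxy, hne⟩
    by_cases hx : x ∈ E
    · right
      exact Set.mem_biUnion (hstep x y hx (by tauto) hxy) hxy.symm
    · left
      exact hstep y x (by tauto) hx hxy.symm
  · obtain ⟨M, hM⟩ := exists_index_forall_gt_vertex_notMem α hS
    filter_upwards [Filter.eventually_ge_atTop (M + N + 2)] with i hi
    have : α.vertex i = α'.vertex (i - (N + 1)) := by
      change _ = α.vertex (i - (N + 1) + (N + 1))
      congr 1
      omega
    rw [this]
    refine ⟨_, Walk.nil, fun z hz => ?_⟩
    rw [Walk.support_nil, List.mem_singleton] at hz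
    rw [hz, ← this]
    exact hM i (by omega)
  · rintro i ⟨k, p, hp⟩
    obtain ⟨z, hz, hzS⟩ := hsep k i p
    exact hp z hz hzS

theorem eventually_mem_or_eventually_notMem {D : Set V} (hD : (Γ.edgeBoundaryVertices D).Finite)
    (α : GraphRay Γ) : (∀ᶠ i in Filter.atTop, α.vertex i ∈ D) ∨
      (∀ᶠ i in Filter.atTop, α.vertex i ∉ D) := by
  obtain ⟨N, hN⟩ := exists_index_forall_gt_vertex_notMem α hD
  have hstep : ∀ i, N < i → (α.vertex i ∈ D ↔ α.vertex (i + 1) ∈ D) := by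
    intro i hi
    by_contra hne
    exact hN i hi ⟨_, α.adj i, hne⟩
  have hconst : ∀ i, N + 1 ≤ i → (α.vertex i ∈ D ↔ α.vertex (N + 1) ∈ D) := by
    intro i hi
    induction i, hi using Nat.le_induction with
    | base => rfl
    | succ i hi ih => rw [← hstep i (by omega), ih]
  by_cases h : α.vertex (N + 1) ∈ D
  · left
    filter_upwards [Filter.eventually_ge_atTop (N + 1)] with i hi
    exact (hconst i hi).2 h
  · right
    filter_upwards [Filter.eventually_ge_atTop (N + 1)] with i hi
    exact fun h' => h ((hconst i hi).1 h')

theorem eventually_mem_of_infinite_inter {D : Set V} (hD : (Γ.edgeBoundaryVertices D).Finite)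
    {α β : GraphRay Γ} (h : (Set.range α.vertex ∩ Set.range β.vertex).Infinite)
    (hα : ∀ᶠ i in Filter.atTop, α.vertex i ∈ D) : ∀ᶠ i in Filter.atTop, β.vertex i ∈ D := by
  refine (eventually_mem_or_eventually_notMem hD β).resolve_right fun hβ => h ?_
  obtain ⟨M, hM⟩ := Filter.eventually_atTop.1 hα
  obtain ⟨N, hN⟩ := Filter.eventually_atTop.1 hβ
  refine (((Set.finite_Iio M).image α.vertex).union ((Set.finite_Iio N).image β.vertex)).subset ?_
  rintro x ⟨⟨i, rfl⟩, ⟨j, hj⟩⟩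
  by_cases hi : i < M
  · exact Or.inl ⟨i, hi, rfl⟩
  · right
    refine ⟨j, ?_, hj⟩
    by_contra hjN
    exact hN j (not_lt.1 hjN) (hj ▸ hM i (not_lt.1 hi))

theorem GraphRay.Equivalent.eventually_mem_iff {D : Set V}
    (hD : (Γ.edgeBoundaryVertices D).Finite) {α β : GraphRay Γ} (h : α.Equivalent β) :
    (∀ᶠ i in Filter.atTop, α.vertex i ∈ D) ↔ ∀ᶠ i in Filter.atTop, β.vertex i ∈ D := by
  obtain ⟨γ, h1, h2⟩ := h
  constructor
  · intro h
    exact eventually_mem_of_infinite_inter hD h2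
      (eventually_mem_of_infinite_inter hD (Set.inter_comm _ _ ▸ h1) h)
  · intro h
    exact eventually_mem_of_infinite_inter hD h1
      (eventually_mem_of_infinite_inter hD (Set.inter_comm _ _ ▸ h2) h)

/-- Whether the rays of an end eventually lie in a given set with finite boundary. -/
def endEventuallyMem {D : Set V} (hD : (Γ.edgeBoundaryVertices D).Finite) (e : GraphEnd Γ) : Prop :=
  Quot.lift (fun α : GraphRay Γ => ∀ᶠ i in Filter.atTop, α.vertex i ∈ D)
    (fun _ _ h => propext (GraphRay.Equivalent.eventually_mem_iff hD h)) e

theorem infinite_of_eventually_mem {D : Set V} {α : GraphRay Γ}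
    (h : ∀ᶠ i in Filter.atTop, α.vertex i ∈ D) : D.Infinite := by
  obtain ⟨N, hN⟩ := Filter.eventually_atTop.1 h
  exact Set.infinite_of_injective_forall_mem (f := fun i => α.vertex (i + N))
    (fun i j hij => by have := α.injective hij; omega) fun i => hN _ (by omega)

theorem isTwoEnded_of_card_graphEnd (hΓ : Γ.Connected) (hfin : ∀ x, (Γ.neighborSet x).Finite)
    (h : Nat.card (GraphEnd Γ) = 2) : Γ.IsTwoEnded := by
  obtain ⟨a, b, hab, huniv⟩ := Nat.card_eq_two_iff.1 h
  obtain ⟨α, rfl⟩ := Quot.exists_rep a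
  obtain ⟨β, rfl⟩ := Quot.exists_rep b
  have hne : ¬ α.Equivalent β := fun h => hab (Quot.sound h)
  obtain ⟨C, hC, hα, hβ⟩ := exists_separating_of_not_equivalent hfin hne
  have hβ' : ∀ᶠ i in Filter.atTop, β.vertex i ∈ Cᶜ := Filter.Eventually.of_forall hβ
  have hC' : (Γ.edgeBoundaryVertices Cᶜ).Finite := by rwa [edgeBoundaryVertices_compl]
  have hnot : ∀ {D : Set V} {γ : GraphRay Γ}, (∀ᶠ i in Filter.atTop, γ.vertex i ∈ D) →
      ¬ ∀ᶠ i in Filter.atTop, γ.vertex i ∈ Dᶜ := by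
    intro D γ h1 h2
    obtain ⟨i, h3, h4⟩ := (h1.and h2).exists
    exact h4 h3
  have key : ∀ (E : Set V) (hE : (Γ.edgeBoundaryVertices E).Finite) (δ : GraphRay Γ),
      (∀ᶠ i in Filter.atTop, δ.vertex i ∈ Eᶜ) → ∀ D : Set V,
      (Γ.edgeBoundaryVertices D).Finite → (E ∩ D).Finite ∨ (E ∩ Dᶜ).Finite := by
    intro E hE δ hδ D hD
    by_contra! hcon
    have hD' : (Γ.edgeBoundaryVertices Dᶜ).Finite := by rwa [edgeBoundaryVertices_compl]
    obtain ⟨γ₁, h₁⟩ := exists_ray_subset hΓ hfin hcon.1 (finite_edgeBoundaryVertices_inter hE hD)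
    obtain ⟨γ₂, h₂⟩ := exists_ray_subset hΓ hfin hcon.2 (finite_edgeBoundaryVertices_inter hE hD')
    have e₁ : ∀ᶠ i in Filter.atTop, γ₁.vertex i ∈ E := Filter.Eventually.of_forall fun i => (h₁ i).1
    have e₂ : ∀ᶠ i in Filter.atTop, γ₂.vertex i ∈ E := Filter.Eventually.of_forall fun i => (h₂ i).1
    have d₁ : ∀ᶠ i in Filter.atTop, γ₁.vertex i ∈ D := Filter.Eventually.of_forall fun i => (h₁ i).2
    have d₂ : ∀ᶠ i in Filter.atTop, γ₂.vertex i ∈ Dᶜ :=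
      Filter.Eventually.of_forall fun i => (h₂ i).2
    have hdist : ∀ {F : Set V} (hF : (Γ.edgeBoundaryVertices F).Finite) {σ τ : GraphRay Γ},
        (∀ᶠ i in Filter.atTop, σ.vertex i ∈ F) → (∀ᶠ i in Filter.atTop, τ.vertex i ∈ Fᶜ) →
        (Quot.mk _ σ : GraphEnd Γ) ≠ Quot.mk _ τ := by
      intro F hF σ τ hσ hτ heq
      have h1 : endEventuallyMem hF (Quot.mk _ σ) := hσ
      rw [heq] at h1
      exact hnot h1 hτ
    have n12 := hdist hD d₁ d₂
    have n1 := hdist hE e₁ hδ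
    have n2 := hdist hE e₂ hδ
    have hmem : ∀ e : GraphEnd Γ, e = Quot.mk _ α ∨ e = Quot.mk _ β := by
      intro e
      have : e ∈ (Set.univ : Set (GraphEnd Γ)) := trivial
      rw [← huniv] at this
      exact this
    rcases hmem (Quot.mk _ γ₁) with a1 | a1 <;> rcases hmem (Quot.mk _ γ₂) with a2 | a2 <;>
      rcases hmem (Quot.mk _ δ) with a3 | a3 <;> simp_all
  exact ⟨C, hC, infinite_of_eventually_mem hα, infinite_of_eventually_mem hβ', fun D hD =>
    ⟨key C hC β hβ' D hD, key Cᶜ hC' α (by rwa [compl_compl]) D hD⟩⟩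

theorem IsTwoEnded.card_graphEnd (hΓ : Γ.Connected) (hfin : ∀ x, (Γ.neighborSet x).Finite)
    (h : Γ.IsTwoEnded) : Nat.card (GraphEnd Γ) = 2 := by
  obtain ⟨C, hC, hinf, hinf', hsides⟩ := h
  have hC' : (Γ.edgeBoundaryVertices Cᶜ).Finite := by rwa [edgeBoundaryVertices_compl]
  have hequiv : ∀ E : Set V, (∀ D : Set V, (Γ.edgeBoundaryVertices D).Finite →
      (E ∩ D).Finite ∨ (E ∩ Dᶜ).Finite) → ∀ α β : GraphRay Γ,
      (∀ᶠ i in Filter.atTop, α.vertex i ∈ E) → (∀ᶠ i in Filter.atTop, β.vertex i ∈ E) →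
      α.Equivalent β := by
    intro E hE α β hα hβ
    by_contra hne
    obtain ⟨D, hD, h1, h2⟩ := exists_separating_of_not_equivalent hfin hne
    rcases hE D hD with h | h
    · exact infinite_of_eventually_mem (hα.and h1) h
    · exact infinite_of_eventually_mem (hβ.and (Filter.Eventually.of_forall h2)) h
  have hbij : Function.Bijective (endEventuallyMem hC) := by
    constructor
    · rintro ⟨α⟩ ⟨β⟩ h
      refine Quot.sound ?_
      have h' : (∀ᶠ i in Filter.atTop, α.vertex i ∈ C) ↔ ∀ᶠ i in Filter.atTop, β.vertex i ∈ C :=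
        iff_of_eq h
      by_cases hα : ∀ᶠ i in Filter.atTop, α.vertex i ∈ C
      · exact hequiv C (fun D hD => (hsides D hD).1) α β hα (h'.1 hα)
      · exact hequiv Cᶜ (fun D hD => (hsides D hD).2) α β
          ((eventually_mem_or_eventually_notMem hC α).resolve_left hα)
          ((eventually_mem_or_eventually_notMem hC β).resolve_left fun hβ => hα (h'.2 hβ))
    · intro P
      by_cases hP : P
      · obtain ⟨γ, hγ⟩ := exists_ray_subset hΓ hfin hinf hC
        exact ⟨Quot.mk _ γ, propext ⟨fun _ => hP, fun _ => Filter.Eventually.of_forall hγ⟩⟩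
      · obtain ⟨γ, hγ⟩ := exists_ray_subset hΓ hfin hinf' hC'
        refine ⟨Quot.mk _ γ, propext ⟨fun h => ?_, fun h => absurd h hP⟩⟩
        have h : ∀ᶠ i in Filter.atTop, γ.vertex i ∈ C := h
        obtain ⟨i, hi⟩ := h.exists
        exact absurd hi (hγ i)
  rw [Nat.card_congr (Equiv.ofBijective _ hbij)]
  simp

end SimpleGraph

namespace SimpleGraph

variable {V : Type v} {Γ : SimpleGraph V}

/-- No set whose boundary avoids `F` cuts `F` into two nonempty pieces. -/
def IsUnsplit (Γ : SimpleGraph V) (F : Set V) : Prop :=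
  ∀ D : Set V, Disjoint F (Γ.edgeBoundaryVertices D) → F ⊆ D ∨ F ⊆ Dᶜ

theorem Walk.mem_iff_of_disjoint_edgeBoundaryVertices {D : Set V} {a b : V} (p : Γ.Walk a b)
    (h : ∀ z ∈ p.support, z ∉ Γ.edgeBoundaryVertices D) : ∀ z ∈ p.support, z ∈ D ↔ a ∈ D := by
  induction p with
  | nil => simp
  | @cons a b c hab p ih =>
    intro z hz
    rw [Walk.support_cons, List.mem_cons] at hz
    rcases hz with rfl | hz
    · rfl
    · have h1 := ih (fun z hz => h z (by simp [hz])) z hz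
      rw [h1]
      by_contra hne
      exact h a (by simp) ⟨b, hab, by tauto⟩

theorem eq_univ_of_edgeBoundaryVertices_eq_empty (hΓ : Γ.Connected) {D : Set V}
    (hD : D.Nonempty) (h : Γ.edgeBoundaryVertices D = ∅) : D = Set.univ := by
  obtain ⟨x, hx⟩ := hD
  refine Set.eq_univ_of_forall fun y => ?_
  obtain ⟨p⟩ := hΓ.preconnected x y
  exact (p.mem_iff_of_disjoint_edgeBoundaryVertices (by simp [h]) y p.end_mem_support).2 hx

theorem exists_isUnsplit_superset (hΓ : Γ.Connected) {A : Set V} (hA : A.Finite) :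
    ∃ F : Set V, F.Finite ∧ A ⊆ F ∧ Γ.IsUnsplit F := by
  obtain ⟨v⟩ := hΓ.nonempty
  have w : ∀ x, Γ.Walk v x := fun x => (hΓ.preconnected v x).some
  refine ⟨⋃ x ∈ A, {z | z ∈ (w x).support}, hA.biUnion fun x _ => List.finite_toSet _, ?_, ?_⟩
  · exact fun x hx => Set.mem_biUnion hx (w x).end_mem_support
  · intro D hD
    have key : ∀ z ∈ ⋃ x ∈ A, {z | z ∈ (w x).support}, z ∈ D ↔ v ∈ D := by
      intro z hz
      obtain ⟨x, hx, hz⟩ := Set.mem_iUnion₂.1 hz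
      exact (w x).mem_iff_of_disjoint_edgeBoundaryVertices
        (fun y hy => Set.disjoint_left.1 hD (Set.mem_biUnion hx hy)) z hz
    by_cases hv : v ∈ D
    · exact Or.inl fun z hz => (key z hz).2 hv
    · exact Or.inr fun z hz hz' => hv ((key z hz).1 hz')

theorem finite_inter_or_finite_inter_compl_of_chain {F : ℤ → Set V} (hfin : ∀ i, (F i).Finite)
    (hun : ∀ i, Γ.IsUnsplit (F i)) (hne : ∀ i, (F i ∩ F (i + 1)).Nonempty)
    (hloc : ∀ x, {i | x ∈ F i}.Finite) {E : Set V} (hE : E ⊆ ⋃ i ∈ Set.Ici (0 : ℤ), F i)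
    {D : Set V} (hD : (Γ.edgeBoundaryVertices D).Finite) :
    (E ∩ D).Finite ∨ (E ∩ Dᶜ).Finite := by
  obtain ⟨N, hN⟩ := (hD.biUnion fun x _ => hloc x).bddAbove
  have hdisj : ∀ i, N < i → Disjoint (F i) (Γ.edgeBoundaryVertices D) := by
    intro i hi
    rw [Set.disjoint_left]
    intro x hx hxD
    exact absurd (hN (Set.mem_biUnion hxD hx)) (not_le.2 hi)
  have hprop : ∀ D' : Set V, Γ.edgeBoundaryVertices D' = Γ.edgeBoundaryVertices D →
      F (N + 1) ⊆ D' → (E ∩ D'ᶜ).Finite := by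
    intro D' hD' h0
    have hall : ∀ i, N + 1 ≤ i → F i ⊆ D' := by
      intro i hi
      induction i, hi using Int.leInduction with
      | base => exact h0
      | succ i hi ih =>
        refine (hun (i + 1) D' (hD' ▸ hdisj _ (by omega))).resolve_right fun h => ?_
        obtain ⟨x, hx, hx'⟩ := hne i
        exact h hx' (ih hx)
    refine ((Set.finite_Icc (0 : ℤ) N).biUnion fun i _ => hfin i).subset ?_
    rintro x ⟨hxE, hxD⟩
    obtain ⟨i, hi, hx⟩ := Set.mem_iUnion₂.1 (hE hxE)
    refine Set.mem_biUnion (show i ∈ Set.Icc 0 N from ⟨hi, ?_⟩) hx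
    by_contra! hlt
    exact hxD (hall i (by omega) hx)
  rcases hun (N + 1) D (hdisj _ (by omega)) with h | h
  · exact Or.inr (hprop D rfl h)
  · left
    have := hprop Dᶜ (edgeBoundaryVertices_compl D) h
    rwa [compl_compl] at this

/-- A graph that is covered by a bi-infinite chain of finite connected pieces with bounded overlap
is two-ended. -/
theorem isTwoEnded_of_chain {F : ℤ → Set V} (hfin : ∀ i, (F i).Finite)
    (hun : ∀ i, Γ.IsUnsplit (F i)) (hne : ∀ i, (F i ∩ F (i + 1)).Nonempty) (M : ℤ)
    (hM : ∀ i j, (F i ∩ F j).Nonempty → j - i ≤ M) (hcov : ∀ x, ∃ i, x ∈ F i)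
    (hedge : ∀ x y, Γ.Adj x y → ∃ i, x ∈ F i ∧ y ∈ F i) : Γ.IsTwoEnded := by
  have hloc : ∀ x, {i | x ∈ F i}.Finite := by
    intro x
    obtain ⟨j, hj⟩ := hcov x
    refine (Set.finite_Icc (j - M) (j + M)).subset fun i hi => ?_
    have h1 := hM i j ⟨x, hi, hj⟩
    have h2 := hM j i ⟨x, hj, hi⟩
    exact ⟨by omega, by omega⟩
  have hinf : ∀ (I : Set ℤ) (C : Set V), I.Infinite → (∀ i ∈ I, F i ⊆ C) → C.Infinite := by
    intro I C hI hIC hC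
    refine hI ((hC.biUnion fun x _ => hloc x).subset fun i hi => ?_)
    obtain ⟨x, hx, -⟩ := hne i
    exact Set.mem_biUnion (hIC i hi hx) hx
  set C : Set V := ⋃ i ∈ Set.Ici (0 : ℤ), F i with hC
  have hmemC : ∀ i, 0 ≤ i → F i ⊆ C := fun i hi => Set.subset_biUnion_of_mem (u := F) hi
  have hlow : ∀ k x, x ∈ F k → x ∈ C → -M ≤ k := by
    intro k x hk hx
    obtain ⟨i, hi, hx⟩ := Set.mem_iUnion₂.1 hx
    have := hM k i ⟨x, hk, hx⟩
    have hi : 0 ≤ i := hi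
    omega
  refine ⟨C, ?_, hinf (Set.Ici 0) C (Set.Ici_infinite 0) hmemC,
    hinf (Set.Iio (-M)) Cᶜ (Set.Iio_infinite _) fun i hi x hx hxC =>
      absurd (hlow i x hx hxC) (not_le.2 hi), fun D hD => ⟨?_, ?_⟩⟩
  · refine ((Set.finite_Icc (-M) 0).biUnion fun i _ => hfin i).subset ?_
    rintro x ⟨y, hxy, hne⟩
    obtain ⟨k, hxk, hyk⟩ := hedge x y hxy
    refine Set.mem_biUnion (show k ∈ Set.Icc (-M) 0 from ⟨?_, ?_⟩) hxk
    · by_cases hx : x ∈ C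
      · exact hlow k x hxk hx
      · exact hlow k y hyk (by tauto)
    · by_contra! hk
      exact hne ⟨fun _ => hmemC k hk.le hyk, fun _ => hmemC k hk.le hxk⟩
  · exact finite_inter_or_finite_inter_compl_of_chain hfin hun hne hloc subset_rfl hD
  · refine finite_inter_or_finite_inter_compl_of_chain (F := fun i => F (-i)) (fun i => hfin _)
      (fun i => hun _) (fun i => ?_) (fun x => ?_) (fun x hx => ?_) hD
    · have := hne (-i - 1)
      rw [sub_add_cancel, Set.inter_comm] at this
      rwa [neg_add']
    · exact (hloc x).preimage neg_injective.injOn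
    · obtain ⟨i, hi⟩ := hcov x
      refine Set.mem_biUnion (show -i ∈ Set.Ici 0 from ?_) (show x ∈ F (- -i) by rwa [neg_neg])
      by_contra hneg
      exact hx (hmemC i (by simp only [Set.mem_Ici] at hneg; omega) hi)

section TwoRegular

theorem eq_or_eq_of_adj_of_ncard_eq_two {x a b c : V} (h : (Γ.neighborSet x).ncard = 2)
    (ha : Γ.Adj x a) (hb : Γ.Adj x b) (hab : a ≠ b) (hc : Γ.Adj x c) : c = a ∨ c = b := by
  obtain ⟨p, q, -, hpq⟩ := Set.ncard_eq_two.1 h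
  have key : ∀ z, Γ.Adj x z → z = p ∨ z = q := by
    intro z hz
    have : z ∈ Γ.neighborSet x := hz
    rw [hpq] at this
    exact this
  rcases key a ha with rfl | rfl <;> rcases key b hb with rfl | rfl <;>
    rcases key c hc with rfl | rfl <;> simp_all

/-- A one-way infinite walk that never immediately reverses. -/
def IsNonbacktracking (Γ : SimpleGraph V) (s : ℕ → V) : Prop :=
  ∀ n, Γ.Adj (s n) (s (n + 1)) ∧ s (n + 2) ≠ s n

theorem exists_isNonbacktracking (h2 : ∀ x, (Γ.neighborSet x).ncard = 2) (d : Γ.Dart) :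
    ∃ s : ℕ → V, Γ.IsNonbacktracking s ∧ s 0 = d.fst ∧ s 1 = d.snd := by
  have hnext : ∀ d : Γ.Dart, ∃ d' : Γ.Dart, d'.fst = d.snd ∧ d'.snd ≠ d.fst := by
    intro d
    obtain ⟨p, q, hne, hpq⟩ := Set.ncard_eq_two.1 (h2 d.snd)
    have hp : Γ.Adj d.snd p := by
      change p ∈ Γ.neighborSet d.snd
      simp [hpq]
    have hq : Γ.Adj d.snd q := by
      change q ∈ Γ.neighborSet d.snd
      simp [hpq]
    by_cases h : p = d.fst
    · exact ⟨⟨(d.snd, q), hq⟩, rfl, fun h' => hne (h.trans h'.symm)⟩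
    · exact ⟨⟨(d.snd, p), hp⟩, rfl, h⟩
  choose next hfst hsnd using hnext
  have hit : ∀ n, next^[n + 1] d = next (next^[n] d) := fun n =>
    Function.iterate_succ_apply' next n d
  have hs : ∀ n, (next^[n + 1] d).fst = (next^[n] d).snd := fun n => by rw [hit, hfst]
  refine ⟨fun n => (next^[n] d).fst, fun n => ⟨?_, ?_⟩, rfl, hs 0⟩
  · change Γ.Adj _ (next^[n + 1] d).fst
    rw [hs]
    exact (next^[n] d).adj
  · change (next^[n + 1 + 1] d).fst ≠ _
    rw [hs, hit]
    exact hsnd _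

theorem IsNonbacktracking.injective (hΓ : Γ.Connected) (h2 : ∀ x, (Γ.neighborSet x).ncard = 2)
    [Infinite V] {s : ℕ → V} (hs : Γ.IsNonbacktracking s) : Function.Injective s := by
  have hprev : ∀ n, 1 ≤ n → Γ.Adj (s n) (s (n - 1)) := by
    intro n hn
    have := (hs (n - 1)).1
    rw [Nat.sub_add_cancel hn] at this
    exact this.symm
  have hback : ∀ n, 1 ≤ n → s (n - 1) ≠ s (n + 1) := by
    intro n hn h
    refine (hs (n - 1)).2 ?_
    rw [h]
    congr 1
    omega
  have key : ∀ j i, i < j → s i ≠ s j := by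
    intro j
    induction j using Nat.strong_induction_on with
    | _ j ih =>
      intro i hij heq
      have hj1 : j ≠ i + 1 := by
        rintro rfl
        exact (hs i).1.ne heq
      have hj2 : j ≠ i + 2 := by
        rintro rfl
        exact (hs i).2 heq.symm
      have hadj : Γ.Adj (s i) (s (j - 1)) := heq ▸ hprev j (by omega)
      rcases Nat.eq_zero_or_pos i with rfl | hi
      · have hT : Γ.edgeBoundaryVertices (s '' Set.Iio j) = ∅ := by
          have hclosed : ∀ x y, x ∈ s '' Set.Iio j → Γ.Adj x y → y ∈ s '' Set.Iio j := by
            rintro _ y ⟨k, hk, rfl⟩ hy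
            have hk : k < j := hk
            rcases Nat.eq_zero_or_pos k with rfl | hk0
            · rcases eq_or_eq_of_adj_of_ncard_eq_two (h2 _) (hs 0).1 hadj
                (ih (j - 1) (by omega) 1 (by omega)) hy with h | h
              · exact ⟨1, by simp only [Set.mem_Iio]; omega, h.symm⟩
              · exact ⟨j - 1, by simp only [Set.mem_Iio]; omega, h.symm⟩
            · rcases eq_or_eq_of_adj_of_ncard_eq_two (h2 _) (hprev k hk0) (hs k).1
                (hback k hk0) hy with h | h
              · exact ⟨k - 1, by simp only [Set.mem_Iio]; omega, h.symm⟩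
              · by_cases hkj : k + 1 = j
                · exact ⟨0, by simp only [Set.mem_Iio]; omega, by rw [h, hkj, heq]⟩
                · exact ⟨k + 1, by simp only [Set.mem_Iio]; omega, h.symm⟩
          refine Set.eq_empty_of_forall_notMem ?_
          rintro x ⟨y, hxy, hne⟩
          exact hne ⟨fun hx => hclosed x y hx hxy, fun hy => hclosed y x hy hxy.symm⟩
        have huniv := eq_univ_of_edgeBoundaryVertices_eq_empty hΓ
          (Set.Nonempty.image s ⟨0, hij⟩) hT
        exact Set.infinite_univ (huniv ▸ (Set.finite_Iio j).image s)
      · rcases eq_or_eq_of_adj_of_ncard_eq_two (h2 _) (hprev i hi) (hs i).1 (hback i hi)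
          hadj with h | h
        · exact ih (j - 1) (by omega) (i - 1) (by omega) h.symm
        · exact ih (j - 1) (by omega) (i + 1) (by omega) h.symm
  intro i j hij
  rcases lt_trichotomy i j with h | h | h
  · exact absurd hij (key j i h)
  · exact h
  · exact absurd hij.symm (key i j h)

theorem isTwoEnded_of_ncard_neighborSet_eq_two (hΓ : Γ.Connected)
    (h2 : ∀ x, (Γ.neighborSet x).ncard = 2) [Infinite V] : Γ.IsTwoEnded := by
  obtain ⟨x₀⟩ := hΓ.nonempty
  obtain ⟨x₁, hx⟩ : ∃ y, Γ.Adj x₀ y := by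
    obtain ⟨p, q, -, hpq⟩ := Set.ncard_eq_two.1 (h2 x₀)
    refine ⟨p, ?_⟩
    change p ∈ Γ.neighborSet x₀
    simp [hpq]
  obtain ⟨s, hs, hs0, hs1⟩ := exists_isNonbacktracking h2 ⟨(x₀, x₁), hx⟩
  obtain ⟨t, ht, ht0, ht1⟩ := exists_isNonbacktracking h2 ⟨(x₁, x₀), hx.symm⟩
  let u : ℤ → V := fun k => if 0 ≤ k then s k.toNat else t (1 - k).toNat
  have hupos : ∀ (k : ℤ) (n : ℕ), k = n → u k = s n := by
    rintro k n rfl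
    simp [u]
  have huneg : ∀ (k : ℤ) (n : ℕ), k = 1 - n → u k = t n := by
    intro k n hk
    by_cases h : 0 ≤ k
    · have hn : n = 0 ∨ n = 1 := by omega
      rcases hn with rfl | rfl
      · rw [hupos k 1 (by omega), hs1, ht0]
      · rw [hupos k 0 (by omega), hs0, ht1]
    · simp only [u, h, if_false]
      congr 1
      omega
  have hadj : ∀ k, Γ.Adj (u k) (u (k + 1)) := by
    intro k
    by_cases h : 0 ≤ k
    · rw [hupos k k.toNat (by omega), hupos (k + 1) (k.toNat + 1) (by omega)]
      exact (hs _).1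
    · rw [huneg k ((-k).toNat + 1) (by omega), huneg (k + 1) (-k).toNat (by omega)]
      exact (ht _).1.symm
  have hback : ∀ k, u (k + 2) ≠ u k := by
    intro k
    by_cases h : 0 ≤ k
    · rw [hupos k k.toNat (by omega), hupos (k + 2) (k.toNat + 2) (by omega)]
      exact (hs _).2
    · rw [huneg k ((-1 - k).toNat + 2) (by omega), huneg (k + 2) (-1 - k).toNat (by omega)]
      exact (ht _).2.symm
  have hinj : ∀ i j, u i = u j → i ≤ j → i = j := by
    intro i j hij hle
    have hnb : Γ.IsNonbacktracking fun n : ℕ => u (i + n) := by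
      refine fun n => ⟨?_, ?_⟩
      · have := hadj (i + n)
        rwa [add_assoc] at this
      · have := hback (i + n)
        rwa [add_assoc] at this
    have h := hnb.injective hΓ h2 (a₁ := 0) (a₂ := (j - i).toNat) (by
      rw [show i + ((j - i).toNat : ℤ) = j by omega, ← hij]
      simp)
    omega
  have hinj' : Function.Injective u := by
    intro i j hij
    rcases le_total i j with h | h
    · exact hinj i j hij h
    · exact (hinj j i hij.symm h).symm
  have hnbr : ∀ k y, Γ.Adj (u k) y → y = u (k - 1) ∨ y = u (k + 1) := by
    intro k y hy
    have h1 := hadj (k - 1)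
    have h3 := hback (k - 1)
    rw [sub_add_cancel] at h1
    rw [show k - 1 + 2 = k + 1 by ring] at h3
    exact eq_or_eq_of_adj_of_ncard_eq_two (h2 _) h1.symm (hadj k) h3.symm hy
  have hsurj : Set.range u = Set.univ := by
    refine eq_univ_of_edgeBoundaryVertices_eq_empty hΓ (Set.range_nonempty u)
      (Set.eq_empty_of_forall_notMem ?_)
    have hclosed : ∀ x y, x ∈ Set.range u → Γ.Adj x y → y ∈ Set.range u := by
      rintro _ y ⟨k, rfl⟩ hy
      rcases hnbr k y hy with h | h <;> exact ⟨_, h.symm⟩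
    rintro x ⟨y, hxy, hne⟩
    exact hne ⟨fun hx => hclosed x y hx hxy, fun hy => hclosed y x hy hxy.symm⟩
  have hsurj' : ∀ x, ∃ k, u k = x := fun x => Set.range_eq_univ.1 hsurj x
  refine isTwoEnded_of_chain (F := fun i => {u i, u (i + 1)}) (fun i => Set.toFinite _) ?_
    (fun i => ⟨u (i + 1), by simp⟩) 1 ?_ ?_ ?_
  · intro i D hD
    have hiff : u i ∈ D ↔ u (i + 1) ∈ D := by
      by_contra hne
      exact Set.disjoint_left.1 hD (by simp) ⟨_, hadj i, hne⟩
    by_cases h : u i ∈ D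
    · left
      rintro x (rfl | rfl)
      exacts [h, hiff.1 h]
    · right
      rintro x (rfl | rfl)
      exacts [h, fun h' => h (hiff.2 h')]
  · rintro i j ⟨x, (rfl | rfl), (h | h)⟩ <;> have := hinj' h <;> omega
  · intro x
    obtain ⟨k, rfl⟩ := hsurj' x
    exact ⟨k, by simp⟩
  · intro x y hxy
    obtain ⟨k, rfl⟩ := hsurj' x
    rcases hnbr k y hxy with rfl | rfl
    · exact ⟨k - 1, by simp⟩
    · exact ⟨k, by simp⟩

end TwoRegular

end SimpleGraph

section FiniteDifference

variable {α : Type*}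

/-- The two sets differ in finitely many points. -/
def AlmostEqual (A B : Set α) : Prop := (A \ B).Finite ∧ (B \ A).Finite

/-- The signed number of points in which two almost equal sets differ. -/
noncomputable def diffIndex (A B : Set α) : ℤ := ((A \ B).ncard : ℤ) - ((B \ A).ncard : ℤ)

theorem AlmostEqual.refl (A : Set α) : AlmostEqual A A := by simp [AlmostEqual]

theorem AlmostEqual.symm {A B : Set α} (h : AlmostEqual A B) : AlmostEqual B A := ⟨h.2, h.1⟩

theorem AlmostEqual.trans {A B C : Set α} (h : AlmostEqual A B) (h' : AlmostEqual B C) :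
    AlmostEqual A C :=
  ⟨(h.1.union h'.1).subset fun x hx => by simp only [Set.mem_union, Set.mem_sdiff] at hx ⊢; tauto,
    (h.2.union h'.2).subset fun x hx => by simp only [Set.mem_union, Set.mem_sdiff] at hx ⊢; tauto⟩

theorem AlmostEqual.compl {A B : Set α} (h : AlmostEqual A B) : AlmostEqual Aᶜ Bᶜ := by
  refine ⟨h.2.subset ?_, h.1.subset ?_⟩ <;>
  · intro x hx
    simp only [Set.mem_sdiff, Set.mem_compl_iff, not_not] at hx ⊢
    tauto

theorem diffIndex_compl (A B : Set α) : diffIndex Aᶜ Bᶜ = -diffIndex A B := by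
  have h1 : Aᶜ \ Bᶜ = B \ A := by ext; simp; tauto
  have h2 : Bᶜ \ Aᶜ = A \ B := by ext; simp; tauto
  rw [diffIndex, diffIndex, h1, h2, neg_sub]

theorem diffIndex_swap (A B : Set α) : diffIndex A B = -diffIndex B A := by
  rw [diffIndex, diffIndex, neg_sub]

theorem diffIndex_eq_ncard_inter {A B T : Set α} (hT : T.Finite) (h1 : A \ B ⊆ T)
    (h2 : B \ A ⊆ T) : diffIndex A B = ((A ∩ T).ncard : ℤ) - ((B ∩ T).ncard : ℤ) := by
  have hA : A ∩ T = (A \ B) ∪ (A ∩ B ∩ T) := by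
    ext x
    have := @h1 x
    simp only [Set.mem_inter_iff, Set.mem_union, Set.mem_sdiff] at this ⊢
    tauto
  have hB : B ∩ T = (B \ A) ∪ (A ∩ B ∩ T) := by
    ext x
    have := @h2 x
    simp only [Set.mem_inter_iff, Set.mem_union, Set.mem_sdiff] at this ⊢
    tauto
  have hf : (A ∩ B ∩ T).Finite := hT.subset Set.inter_subset_right
  rw [hA, hB, Set.ncard_union_eq ?_ (hT.subset h1) hf, Set.ncard_union_eq ?_ (hT.subset h2) hf,
    diffIndex]
  · push_cast
    ring
  · exact Set.disjoint_left.2 fun x hx hx' => hx.2 hx'.1.1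
  · exact Set.disjoint_left.2 fun x hx hx' => hx.2 hx'.1.2

theorem diffIndex_add {A B C : Set α} (h : AlmostEqual A B) (h' : AlmostEqual B C) :
    diffIndex A B + diffIndex B C = diffIndex A C := by
  have h'' := h.trans h'
  have hT := ((h.1.union h.2).union (h'.1.union h'.2)).union (h''.1.union h''.2)
  rw [diffIndex_eq_ncard_inter hT, diffIndex_eq_ncard_inter hT, diffIndex_eq_ncard_inter hT]
  · ring
  all_goals
    intro x hx
    simp only [Set.mem_union]
    tauto

open scoped Pointwise in
theorem AlmostEqual.smul {G : Type*} [Group G] [MulAction G α] {A B : Set α}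
    (h : AlmostEqual A B) (g : G) : AlmostEqual (g • A) (g • B) := by
  rw [AlmostEqual, ← Set.smul_set_sdiff, ← Set.smul_set_sdiff]
  exact ⟨h.1.smul_set, h.2.smul_set⟩

open scoped Pointwise in
theorem diffIndex_smul {G : Type*} [Group G] [MulAction G α] (g : G) (A B : Set α) :
    diffIndex (g • A) (g • B) = diffIndex A B := by
  rw [diffIndex, diffIndex, ← Set.smul_set_sdiff, ← Set.smul_set_sdiff, Set.ncard_smul_set,
    Set.ncard_smul_set]

end FiniteDifference

section DiscreteQuotients

variable {G : Type u} [Group G] [TopologicalSpace G] [IsTopologicalGroup G]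

theorem MonoidHom.preimage_singleton_eq_image_ker {G Q : Type*} [Group G] [Group Q] (f : G →* Q)
    (g : G) :
    f ⁻¹' {f g} = (g * ·) '' (f.ker : Set G) := by
  ext x
  simp only [Set.mem_preimage, Set.mem_singleton_iff, Set.mem_image, SetLike.mem_coe,
    MonoidHom.mem_ker]
  constructor
  · intro h
    exact ⟨g⁻¹ * x, by rw [map_mul, map_inv, h, inv_mul_cancel], by group⟩
  · rintro ⟨y, hy, rfl⟩
    rw [map_mul, hy, mul_one]

theorem MonoidHom.continuous_bot_of_isOpen_ker {Q : Type*} [Group Q] (f : G →* Q)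
    (hf : IsOpen (f.ker : Set G)) : Continuous[_, ⊥] f := by
  let _ : TopologicalSpace Q := ⊥
  have : DiscreteTopology Q := ⟨rfl⟩
  refine continuous_discrete_rng.2 fun q => ?_
  by_cases h : ∃ g, f g = q
  · obtain ⟨g, rfl⟩ := h
    rw [f.preimage_singleton_eq_image_ker]
    exact (Homeomorph.mulLeft g).isOpenMap _ hf
  · convert isOpen_empty
    ext x
    simp only [Set.mem_preimage, Set.mem_singleton_iff, Set.mem_empty_iff_false, iff_false]
    exact fun hx => h ⟨x, hx⟩

theorem MonoidHom.isCompact_preimage_of_isCompact_ker {Q : Type*} [Group Q] (f : G →* Q)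
    (hf : IsCompact (f.ker : Set G)) {S : Set Q} (hS : S.Finite) : IsCompact (f ⁻¹' S) := by
  rw [← Set.biUnion_preimage_singleton]
  refine hS.isCompact_biUnion fun q _ => ?_
  by_cases h : ∃ g, f g = q
  · obtain ⟨g, rfl⟩ := h
    rw [f.preimage_singleton_eq_image_ker]
    exact hf.image (continuous_const_mul g)
  · convert isCompact_empty
    ext x
    simp only [Set.mem_preimage, Set.mem_singleton_iff, Set.mem_empty_iff_false, iff_false]
    exact fun hx => h ⟨x, hx⟩

theorem MonoidHom.surjectsWithCompactOpenKernel {Q : Type*} [Group Q] (f : G →* Q)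
    (hsurj : Function.Surjective f) (hnhds : {g | f g = 1} ∈ 𝓝 (1 : G)) {T : Set G}
    (hT : IsCompact T) (hker : ∀ g, f g = 1 → g ∈ T) : SurjectsWithCompactOpenKernel G Q := by
  have hopen : IsOpen (f.ker : Set G) := Subgroup.isOpen_of_mem_nhds _ hnhds
  exact ⟨f, f.continuous_bot_of_isOpen_ker hopen, hsurj,
    hT.of_isClosed_subset (Subgroup.isClosed_of_isOpen _ hopen) hker, hopen⟩

theorem exists_normalized_additive_function {H : Type*} [Group H] (P : Subgroup H) (φ : H → ℤ)
    (hφ : ∀ g ∈ P, ∀ h ∈ P, φ (g * h) = φ g + φ h) (hne : ∃ g ∈ P, φ g ≠ 0) :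
    ∃ (n : ℤ) (ψ : H → ℤ), n ≠ 0 ∧ (∀ g ∈ P, φ g = n * ψ g) ∧ ∃ t ∈ P, ψ t = 1 := by
  have hφ1 : φ 1 = 0 := by
    have := hφ 1 P.one_mem 1 P.one_mem
    rw [mul_one] at this
    omega
  have hφinv : ∀ g ∈ P, φ g⁻¹ = -φ g := by
    intro g hg
    have := hφ g hg g⁻¹ (P.inv_mem hg)
    rw [mul_inv_cancel, hφ1] at this
    omega
  let I : AddSubgroup ℤ :=
    { carrier := φ '' P
      zero_mem' := ⟨1, P.one_mem, hφ1⟩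
      add_mem' := by
        rintro _ _ ⟨g, hg, rfl⟩ ⟨h, hh, rfl⟩
        exact ⟨g * h, P.mul_mem hg hh, hφ g hg h hh⟩
      neg_mem' := by
        rintro _ ⟨g, hg, rfl⟩
        exact ⟨g⁻¹, P.inv_mem hg, hφinv g hg⟩ }
  obtain ⟨n, hn⟩ := Int.subgroup_cyclic I
  have hmem : ∀ x, x ∈ I ↔ ∃ k : ℤ, k • n = x := fun x => by
    rw [hn, AddSubgroup.mem_closure_singleton]
  have hdvd : ∀ g, ∃ k : ℤ, g ∈ P → φ g = n * k := by
    intro g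
    by_cases hg : g ∈ P
    · obtain ⟨k, hk⟩ := (hmem (φ g)).1 ⟨g, hg, rfl⟩
      exact ⟨k, fun _ => by rw [← hk, smul_eq_mul, mul_comm]⟩
    · exact ⟨0, fun h => absurd h hg⟩
  choose ψ hψ using hdvd
  have hn0 : n ≠ 0 := by
    rintro rfl
    obtain ⟨g, hg, hgne⟩ := hne
    exact hgne (by rw [hψ g hg, zero_mul])
  obtain ⟨t, ht, htn⟩ : n ∈ I := (hmem n).2 ⟨1, one_smul _ _⟩
  refine ⟨n, ψ, hn0, hψ, t, ht, ?_⟩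
  have := hψ t ht
  rw [htn] at this
  exact (mul_eq_left₀ hn0).1 this.symm

/-- A function to `ℤ` that is additive on a subgroup of index at most two, and is inverted by the
conjugations with the elements outside, yields a map onto `ℤ` or onto the infinite dihedral
group. -/
theorem surjects_int_or_dihedral (P : Subgroup G) (hP : ∀ g h, g ∉ P → h ∉ P → g * h ∈ P)
    (φ : G → ℤ) (hφ : ∀ g ∈ P, ∀ h ∈ P, φ (g * h) = φ g + φ h)
    (hinv : ∀ g ∈ P, ∀ t, t ∉ P → φ (t * g * t⁻¹) = -φ g) (hne : ∃ g ∈ P, φ g ≠ 0)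
    (hnhds : {g | g ∈ P ∧ φ g = 0} ∈ 𝓝 (1 : G)) {T : Set G} (hT : IsCompact T)
    (hker : ∀ g ∈ P, φ g = 0 → g ∈ T) :
    SurjectsWithCompactOpenKernel G (Multiplicative ℤ) ∨
      SurjectsWithCompactOpenKernel G (DihedralGroup 0) := by
  classical
  obtain ⟨n, ψ, hn, hψ, t, ht, ht1⟩ := exists_normalized_additive_function P φ hφ hne
  have hψadd : ∀ g ∈ P, ∀ h ∈ P, ψ (g * h) = ψ g + ψ h := by
    intro g hg h hh
    have := hφ g hg h hh
    rw [hψ _ (P.mul_mem hg hh), hψ g hg, hψ h hh, ← mul_add] at this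
    exact mul_left_cancel₀ hn this
  have hψ0 : ∀ g ∈ P, (ψ g = 0 ↔ φ g = 0) := by
    intro g hg
    rw [hψ g hg, mul_eq_zero, or_iff_right hn]
  have hψ1 : ψ 1 = 0 := by
    have := hψadd 1 P.one_mem 1 P.one_mem
    rw [mul_one] at this
    omega
  have hψneg : ∀ g ∈ P, ψ g⁻¹ = -ψ g := by
    intro g hg
    have := hψadd g hg g⁻¹ (P.inv_mem hg)
    rw [mul_inv_cancel, hψ1] at this
    omega
  have hψzpow : ∀ k : ℤ, ψ (t ^ k) = k := by
    intro k
    induction k with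
    | zero => simpa using hψ1
    | succ k ih => rw [zpow_add_one, hψadd _ (P.zpow_mem ht _) _ ht, ih, ht1]
    | pred k ih =>
      rw [zpow_sub_one, hψadd _ (P.zpow_mem ht _) _ (P.inv_mem ht), ih, hψneg t ht, ht1]
      ring
  by_cases hall : ∀ g, g ∈ P
  · left
    let f : G →* Multiplicative ℤ := MonoidHom.mk' (fun g => Multiplicative.ofAdd (ψ g))
      fun g h => by rw [hψadd g (hall g) h (hall h), ofAdd_add]
    have hf : ∀ g, f g = 1 ↔ ψ g = 0 := fun g => ofAdd_eq_one
    refine f.surjectsWithCompactOpenKernel (fun k => ⟨t ^ k.toAdd, ?_⟩) ?_ hT fun g hg => ?_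
    · change Multiplicative.ofAdd (ψ (t ^ k.toAdd)) = k
      rw [hψzpow, ofAdd_toAdd]
    · filter_upwards [hnhds] with g hg
      exact (hf g).2 ((hψ0 g hg.1).2 hg.2)
    · exact hker g (hall g) ((hψ0 g (hall g)).1 ((hf g).1 hg))
  · right
    push Not at hall
    obtain ⟨s, hs⟩ := hall
    have hs' : s⁻¹ ∉ P := fun h => hs (by simpa using P.inv_mem h)
    have hout : ∀ g, g ∉ P → g * s⁻¹ ∈ P := fun g hg => hP g s⁻¹ hg hs'
    have hconj : ∀ g ∈ P, s * g * s⁻¹ ∈ P := by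
      intro g hg
      refine hP (s * g) s⁻¹ (fun h => hs ?_) hs'
      simpa using P.mul_mem h (P.inv_mem hg)
    have hψconj : ∀ g ∈ P, ψ (s * g * s⁻¹) = -ψ g := by
      intro g hg
      have := hinv g hg s hs
      rw [hψ _ (hconj g hg), hψ g hg, ← mul_neg] at this
      exact mul_left_cancel₀ hn this
    have hss : s * s ∈ P := hP s s hs hs
    have hψss : ψ (s * s) = 0 := by
      have := hψconj _ hss
      rw [show s * (s * s) * s⁻¹ = s * s by group] at this
      omega
    let F : G → DihedralGroup 0 := fun g =>
      if g ∈ P then DihedralGroup.r (Int.cast (R := ZMod 0) (ψ g))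
      else DihedralGroup.sr (Int.cast (R := ZMod 0) (-ψ (g * s⁻¹)))
    have hFin : ∀ g, g ∈ P → F g = DihedralGroup.r (Int.cast (R := ZMod 0) (ψ g)) :=
      fun g hg => if_pos hg
    have hFout : ∀ g, g ∉ P → F g = DihedralGroup.sr (Int.cast (R := ZMod 0) (-ψ (g * s⁻¹))) :=
      fun g hg => if_neg hg
    let f : G →* DihedralGroup 0 := MonoidHom.mk' F (by
      intro g h
      by_cases hg : g ∈ P <;> by_cases hh : h ∈ P
      · rw [hFin g hg, hFin h hh, hFin _ (P.mul_mem hg hh), DihedralGroup.r_mul_r,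
          hψadd g hg h hh]
        push_cast
        congr 1
        try ring
      · have hgh : g * h ∉ P := fun hgh => hh (by simpa using P.mul_mem (P.inv_mem hg) hgh)
        rw [hFin g hg, hFout h hh, hFout _ hgh, DihedralGroup.r_mul_sr, mul_assoc,
          hψadd g hg _ (hout h hh)]
        push_cast
        congr 1
        try ring
      · have hgh : g * h ∉ P := fun hgh => hg (by simpa using P.mul_mem hgh (P.inv_mem hh))
        rw [hFout g hg, hFin h hh, hFout _ hgh, DihedralGroup.sr_mul_r,
          show g * h * s⁻¹ = g * s⁻¹ * (s * h * s⁻¹) by group,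
          hψadd _ (hout g hg) _ (hconj h hh), hψconj h hh]
        push_cast
        congr 1
        try ring
      · have hgh : g * h ∈ P := hP g h hg hh
        rw [hFout g hg, hFout h hh, hFin _ hgh, DihedralGroup.sr_mul_sr,
          show g * h = g * s⁻¹ * (s * (h * s⁻¹) * s⁻¹) * (s * s) by group,
          hψadd _ (P.mul_mem (hout g hg) (hconj _ (hout h hh))) _ hss,
          hψadd _ (hout g hg) _ (hconj _ (hout h hh)), hψconj _ (hout h hh), hψss]
        push_cast
        congr 1
        ring)
    have hf : ∀ g, f g = 1 ↔ g ∈ P ∧ ψ g = 0 := by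
      intro g
      change F g = 1 ↔ _
      rw [DihedralGroup.one_def]
      by_cases hg : g ∈ P
      · rw [hFin g hg, DihedralGroup.r.injEq, ZMod.intCast_zmod_eq_zero_iff_dvd, Nat.cast_zero,
          zero_dvd_iff]
        exact ⟨fun h => ⟨hg, h⟩, fun h => h.2⟩
      · rw [hFout g hg]
        exact ⟨fun h => (by cases h), fun h => absurd h.1 hg⟩
    refine f.surjectsWithCompactOpenKernel ?_ ?_ hT fun g hg => ?_
    · rintro (k | k) <;> obtain ⟨k, rfl⟩ := ZMod.intCast_surjective k
      · exact ⟨t ^ k, (hFin _ (P.zpow_mem ht _)).trans (by rw [hψzpow])⟩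
      · have hk : t ^ (-k) * s ∉ P := fun h =>
          hs (by simpa using P.mul_mem (P.inv_mem (P.zpow_mem ht (-k))) h)
        refine ⟨t ^ (-k) * s, (hFout _ hk).trans ?_⟩
        rw [mul_inv_cancel_right, hψzpow, neg_neg]
    · filter_upwards [hnhds] with g hg
      exact (hf g).2 ⟨hg.1, (hψ0 g hg.1).2 hg.2⟩
    · obtain ⟨hg, hg0⟩ := (hf g).1 hg
      exact hker g hg ((hψ0 g hg).1 hg0)

end DiscreteQuotients

section

open scoped Pointwise

namespace SimpleGraph

variable {V : Type v} {Γ : SimpleGraph V}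

theorem inter_eq_empty_of_edgeBoundaryVertices_subset (hΓ : Γ.Connected) {A B : Set V}
    (hA : Γ.edgeBoundaryVertices A ⊆ Bᶜ) (hB : Γ.edgeBoundaryVertices B ⊆ Aᶜ)
    (hne : B ≠ Set.univ) : A ∩ B = ∅ := by
  by_contra hcon
  have hempty : Γ.edgeBoundaryVertices (A ∩ B) = ∅ := by
    have key : ∀ x y, Γ.Adj x y → x ∈ A ∩ B → y ∈ A ∩ B := by
      rintro x y hxy ⟨hxA, hxB⟩
      constructor
      · by_contra hyA
        exact hA ⟨y, hxy, by tauto⟩ hxB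
      · by_contra hyB
        exact hB ⟨y, hxy, by tauto⟩ hxA
    refine Set.eq_empty_of_forall_notMem ?_
    rintro x ⟨y, hxy, hne⟩
    exact hne ⟨key x y hxy, key y x hxy.symm⟩
  have huniv := eq_univ_of_edgeBoundaryVertices_eq_empty hΓ
    (Set.nonempty_iff_ne_empty.2 hcon) hempty
  exact hne (Set.eq_univ_of_univ_subset (huniv ▸ Set.inter_subset_right))

theorem exists_mem_edgeBoundaryVertices (hΓ : Γ.Connected) {C : Set V} (h : C.Nonempty)
    (h' : Cᶜ.Nonempty) : ∃ x ∈ Γ.edgeBoundaryVertices C, x ∈ C := by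
  by_contra! hcon
  have : C ∩ C = ∅ := inter_eq_empty_of_edgeBoundaryVertices_subset hΓ hcon hcon
    fun h => by simp [h] at h'
  rw [Set.inter_self] at this
  exact h.ne_empty this

end SimpleGraph

namespace IsCayleyAbelsGraph

variable {G : Type u} [Group G] [TopologicalSpace G] {V : Type v} [MulAction G V]
  {Γ : SimpleGraph V}

theorem edgeBoundaryVertices_smul (hΓ : IsCayleyAbelsGraph G Γ) (g : G) (D : Set V) :
    Γ.edgeBoundaryVertices (g • D) = g • Γ.edgeBoundaryVertices D := by
  ext x
  rw [Set.mem_smul_set_iff_inv_smul_mem]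
  constructor
  · rintro ⟨y, hxy, hne⟩
    rw [Set.mem_smul_set_iff_inv_smul_mem, Set.mem_smul_set_iff_inv_smul_mem] at hne
    exact ⟨g⁻¹ • y, (hΓ.smul_adj _ _ _).2 hxy, hne⟩
  · rintro ⟨y, hxy, hne⟩
    refine ⟨g • y, ?_, ?_⟩
    · rwa [← hΓ.smul_adj g⁻¹, inv_smul_smul]
    · rwa [Set.mem_smul_set_iff_inv_smul_mem, Set.smul_mem_smul_set_iff]

theorem isUnsplit_smul (hΓ : IsCayleyAbelsGraph G Γ) {F : Set V} (hF : Γ.IsUnsplit F) (g : G) :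
    Γ.IsUnsplit (g • F) := by
  intro D hD
  have h : Disjoint F (Γ.edgeBoundaryVertices (g⁻¹ • D)) := by
    rw [hΓ.edgeBoundaryVertices_smul, Set.disjoint_left]
    intro x hx hx'
    rw [Set.mem_smul_set_iff_inv_smul_mem, inv_inv] at hx'
    exact Set.disjoint_left.1 hD (Set.smul_mem_smul_set hx) hx'
  refine (hF _ h).imp (fun h => ?_) (fun h => ?_)
  · rwa [Set.smul_set_subset_iff_subset_inv_smul_set]
  · rwa [Set.smul_set_subset_iff_subset_inv_smul_set, Set.smul_set_compl]

theorem smul_eq_self_of_forall_edgeBoundaryVertices (hΓ : IsCayleyAbelsGraph G Γ) {C : Set V}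
    (hC : (Γ.edgeBoundaryVertices C).Nonempty) {g : G}
    (hg : ∀ x ∈ Γ.edgeBoundaryVertices C, g • x = x) : g • C = C := by
  have hbd : Γ.edgeBoundaryVertices (g • C) = Γ.edgeBoundaryVertices C := by
    rw [hΓ.edgeBoundaryVertices_smul, ← Set.image_smul]
    exact (Set.image_congr hg).trans (Set.image_id' _)
  have hg' : ∀ x ∈ Γ.edgeBoundaryVertices C, x ∈ g • C ↔ x ∈ C := by
    intro x hx
    rw [Set.mem_smul_set_iff_inv_smul_mem, inv_smul_eq_iff.2 (hg x hx).symm]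
  set D : Set V := {x | x ∈ g • C ↔ x ∈ C} with hD
  obtain ⟨x₀, hx₀⟩ := hC
  have hempty : Γ.edgeBoundaryVertices D = ∅ := by
    have key : ∀ x y, Γ.Adj x y → x ∈ D → y ∈ D := by
      intro x y hxy hx
      by_cases h : x ∈ Γ.edgeBoundaryVertices C
      · by_cases h' : y ∈ Γ.edgeBoundaryVertices C
        · exact hg' y h'
        · have h1 : y ∈ C ↔ x ∈ C := by
            by_contra hne
            exact h' ⟨x, hxy.symm, hne⟩
          have h2 : y ∈ g • C ↔ x ∈ g • C := by
            by_contra hne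
            exact h' (hbd ▸ ⟨x, hxy.symm, hne⟩)
          exact h2.trans (Iff.trans hx h1.symm)
      · have h1 : x ∈ C ↔ y ∈ C := by
          by_contra hne
          exact h ⟨y, hxy, hne⟩
        have h2 : x ∈ g • C ↔ y ∈ g • C := by
          by_contra hne
          exact h (hbd ▸ ⟨y, hxy, hne⟩)
        exact h2.symm.trans (Iff.trans hx h1)
    refine Set.eq_empty_of_forall_notMem ?_
    rintro x ⟨y, hxy, hne⟩
    exact hne ⟨key x y hxy, key y x hxy.symm⟩
  have huniv := SimpleGraph.eq_univ_of_edgeBoundaryVertices_eq_empty hΓ.connected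
    ⟨x₀, hg' x₀ hx₀⟩ hempty
  ext x
  have : x ∈ D := huniv ▸ trivial
  exact this

theorem diffIndex_ne_zero_of_smul_subset (hΓ : IsCayleyAbelsGraph G Γ) {C F : Set V} {g : G}
    (hC : C.Nonempty) (hC' : Cᶜ.Nonempty) (hF : Γ.edgeBoundaryVertices C ⊆ F)
    (hg : AlmostEqual (g • C) C) (h1 : g • F ⊆ C) (h2 : F ⊆ (g • C)ᶜ) :
    diffIndex (g • C) C ≠ 0 := by
  have hsub : (g • C) ∩ Cᶜ = ∅ := by
    refine SimpleGraph.inter_eq_empty_of_edgeBoundaryVertices_subset hΓ.connected ?_ ?_ ?_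
    · rw [hΓ.edgeBoundaryVertices_smul, compl_compl]
      exact (Set.smul_set_mono hF).trans h1
    · rw [SimpleGraph.edgeBoundaryVertices_compl]
      exact hF.trans h2
    · intro h
      rw [Set.compl_univ_iff] at h
      exact hC.ne_empty h
  obtain ⟨c, hc, hcC⟩ := SimpleGraph.exists_mem_edgeBoundaryVertices hΓ.connected hC hC'
  have hpos : 0 < (C \ (g • C)).ncard := (Set.ncard_pos hg.2).2 ⟨c, hcC, h2 (hF hc)⟩
  rw [diffIndex, Set.sdiff_eq, hsub, Set.ncard_empty]
  omega

theorem finite_compl_of_smul_subset (hΓ : IsCayleyAbelsGraph G Γ) {C F : Set V} {g : G}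
    (hC : C.Nonempty) (hF : Γ.edgeBoundaryVertices C ⊆ F)
    (hg : AlmostEqual (g • C) C) (h1 : g • F ⊆ C) (h2 : F ⊆ g • C) : Cᶜ.Finite := by
  have hsub : (g • C)ᶜ ∩ Cᶜ = ∅ := by
    refine SimpleGraph.inter_eq_empty_of_edgeBoundaryVertices_subset hΓ.connected ?_ ?_ ?_
    · rw [SimpleGraph.edgeBoundaryVertices_compl, hΓ.edgeBoundaryVertices_smul, compl_compl]
      exact (Set.smul_set_mono hF).trans h1
    · rw [SimpleGraph.edgeBoundaryVertices_compl, compl_compl]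
      exact hF.trans h2
    · intro h
      rw [Set.compl_univ_iff] at h
      exact hC.ne_empty h
  refine hg.1.subset fun x hx => ⟨?_, hx⟩
  by_contra hxg
  exact (Set.eq_empty_iff_forall_notMem.1 hsub x) ⟨hxg, hx⟩

theorem exists_smul_mem_of_diffIndex_eq_zero (hΓ : IsCayleyAbelsGraph G Γ) {C F : Set V} {g : G}
    (hC : C.Infinite) (hC' : Cᶜ.Infinite) (hF : Γ.edgeBoundaryVertices C ⊆ F)
    (hun : Γ.IsUnsplit F) (hg : AlmostEqual (g • C) C) (h0 : diffIndex (g • C) C = 0) :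
    ∃ x ∈ F, g • x ∈ F := by
  by_contra! hcon
  have hbd : Γ.edgeBoundaryVertices Cᶜ ⊆ F := by
    rwa [SimpleGraph.edgeBoundaryVertices_compl]
  have hgc : AlmostEqual (g • Cᶜ) Cᶜ := by
    rw [Set.smul_set_compl]
    exact hg.compl
  have h0c : diffIndex (g • Cᶜ) Cᶜ = 0 := by
    rw [Set.smul_set_compl, diffIndex_compl, h0, neg_zero]
  have hdisj : Disjoint (g • F) (Γ.edgeBoundaryVertices C) := by
    rw [Set.disjoint_left]
    rintro _ ⟨x, hx, rfl⟩ hx'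
    exact hcon x hx (hF hx')
  have hdisj' : Disjoint F (Γ.edgeBoundaryVertices (g • C)) := by
    rw [hΓ.edgeBoundaryVertices_smul, Set.disjoint_left]
    rintro _ hx' ⟨x, hx, rfl⟩
    exact hcon x (hF hx) hx'
  rcases hΓ.isUnsplit_smul hun g C hdisj with h1 | h1 <;>
    rcases hun (g • C) hdisj' with h2 | h2
  · exact hC' (hΓ.finite_compl_of_smul_subset hC.nonempty hF hg h1 h2)
  · exact hΓ.diffIndex_ne_zero_of_smul_subset hC.nonempty hC'.nonempty hF hg h1 h2 h0
  · refine hΓ.diffIndex_ne_zero_of_smul_subset hC'.nonempty (by rw [compl_compl]; exact hC.nonempty)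
      hbd hgc h1 ?_ h0c
    rwa [Set.smul_set_compl, compl_compl]
  · refine hC ?_
    have := hΓ.finite_compl_of_smul_subset hC'.nonempty hbd hgc h1 (by rwa [Set.smul_set_compl])
    rwa [compl_compl] at this

theorem almostEqual_or_almostEqual_compl {C D : Set V} (hD : D.Infinite) (hD' : Dᶜ.Infinite)
    (h : ((C ∩ D).Finite ∨ (C ∩ Dᶜ).Finite) ∧ ((Cᶜ ∩ D).Finite ∨ (Cᶜ ∩ Dᶜ).Finite)) :
    AlmostEqual D C ∨ AlmostEqual D Cᶜ := by
  rcases h with ⟨h1 | h1, h2 | h2⟩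
  · refine absurd ((h1.union h2).subset fun x hx => ?_) hD
    by_cases hxC : x ∈ C
    exacts [Or.inl ⟨hxC, hx⟩, Or.inr ⟨hxC, hx⟩]
  · refine Or.inr ⟨h1.subset ?_, h2⟩
    rintro x ⟨hx, hxC⟩
    exact ⟨not_not.1 hxC, hx⟩
  · refine Or.inl ⟨h2.subset ?_, h1⟩
    rintro x ⟨hx, hxC⟩
    exact ⟨hxC, hx⟩
  · refine absurd ((h1.union h2).subset fun x hx => ?_) hD'
    by_cases hxC : x ∈ C
    exacts [Or.inl ⟨hxC, hx⟩, Or.inr ⟨hxC, hx⟩]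

variable [IsTopologicalGroup G]

theorem setOf_smul_eq {G : Type u} [Group G] [MulAction G V] (x : V) (g : G) :
    {h : G | h • x = g • x} = (g * ·) '' (MulAction.stabilizer G x : Set G) := by
  ext h
  simp only [Set.mem_ofPred_eq, Set.mem_image, SetLike.mem_coe, MulAction.mem_stabilizer_iff]
  constructor
  · intro hh
    exact ⟨g⁻¹ * h, by rw [mul_smul, hh, inv_smul_smul], by group⟩
  · rintro ⟨k, hk, rfl⟩
    rw [mul_smul, hk]

theorem isCompact_setOf_smul_eq (hΓ : IsCayleyAbelsGraph G Γ) (x y : V) :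
    IsCompact {h : G | h • x = y} := by
  obtain ⟨g, rfl⟩ := hΓ.transitive x y
  rw [setOf_smul_eq]
  exact (hΓ.isCompact_stabilizer x).image (continuous_const_mul g)

theorem isOpen_setOf_smul_eq (hΓ : IsCayleyAbelsGraph G Γ) (x y : V) :
    IsOpen {h : G | h • x = y} := by
  obtain ⟨g, rfl⟩ := hΓ.transitive x y
  rw [setOf_smul_eq]
  exact (Homeomorph.mulLeft g).isOpenMap _ (hΓ.isOpen_stabilizer x)

/-- The elements that move some vertex of `F` into `F`. -/
theorem isCompact_setOf_smul_mem (hΓ : IsCayleyAbelsGraph G Γ) {F : Set V} (hF : F.Finite) :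
    IsCompact {g : G | ∃ x ∈ F, g • x ∈ F} := by
  have : {g : G | ∃ x ∈ F, g • x ∈ F} = ⋃ x ∈ F, ⋃ y ∈ F, {g : G | g • x = y} := by
    ext g
    simp
  rw [this]
  exact hF.isCompact_biUnion fun x _ => hF.isCompact_biUnion fun y _ =>
    hΓ.isCompact_setOf_smul_eq x y

theorem compactSpace_of_finite (hΓ : IsCayleyAbelsGraph G Γ) [Finite V] : CompactSpace G := by
  obtain ⟨v⟩ := hΓ.connected.nonempty
  refine ⟨?_⟩
  convert hΓ.isCompact_setOf_smul_mem (Set.finite_univ (α := V))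
  ext g
  simp only [Set.mem_univ, and_true, Set.mem_ofPred_eq, true_iff]
  exact ⟨v, trivial⟩

theorem finite_of_compactSpace (hΓ : IsCayleyAbelsGraph G Γ) [CompactSpace G] : Finite V := by
  obtain ⟨v⟩ := hΓ.connected.nonempty
  have := Subgroup.quotient_finite_of_isOpen _ (hΓ.isOpen_stabilizer v)
  refine Finite.of_surjective (fun q : G ⧸ MulAction.stabilizer G v =>
    MulAction.ofQuotientStabilizer G v q) fun y => ?_
  obtain ⟨g, rfl⟩ := hΓ.transitive v y
  exact ⟨QuotientGroup.mk g, rfl⟩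

theorem surjects_of_isTwoEnded (hΓ : IsCayleyAbelsGraph G Γ) (h : Γ.IsTwoEnded) :
    SurjectsWithCompactOpenKernel G (Multiplicative ℤ) ∨
      SurjectsWithCompactOpenKernel G (DihedralGroup 0) := by
  obtain ⟨C, hCb, hC, hC', hsides⟩ := h
  have hdich : ∀ g : G, AlmostEqual (g • C) C ∨ AlmostEqual (g • C) Cᶜ := by
    intro g
    refine almostEqual_or_almostEqual_compl ?_ ?_ (hsides _ ?_)
    · rwa [Set.Infinite, Set.finite_smul_set]
    · rwa [← Set.smul_set_compl, Set.Infinite, Set.finite_smul_set]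
    · rw [hΓ.edgeBoundaryVertices_smul]
      exact hCb.smul_set
  have hinvC : ∀ g : G, ∀ A : Set V, AlmostEqual (g • C) A → AlmostEqual (g⁻¹ • A) C := by
    intro g A hg
    have := hg.smul g⁻¹
    rw [inv_smul_smul] at this
    exact this.symm
  let P : Subgroup G :=
    { carrier := {g | AlmostEqual (g • C) C}
      one_mem' := by
        change AlmostEqual ((1 : G) • C) C
        rw [one_smul]
        exact AlmostEqual.refl C
      mul_mem' := by
        intro g h hg hh
        change AlmostEqual ((g * h) • C) C
        rw [mul_smul]
        exact (AlmostEqual.smul hh g).trans hg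
      inv_mem' := fun {g} hg => hinvC g C hg }
  have hmemP : ∀ g, g ∈ P ↔ AlmostEqual (g • C) C := fun g => Iff.rfl
  have hswap : ∀ g, g ∉ P → AlmostEqual (g • C) Cᶜ := fun g hg => (hdich g).resolve_left hg
  obtain ⟨F, hFfin, hF, hun⟩ := SimpleGraph.exists_isUnsplit_superset hΓ.connected hCb
  have hT := hΓ.isCompact_setOf_smul_mem hFfin
  have hker : ∀ g ∈ P, diffIndex (g • C) C = 0 → g ∈ {g : G | ∃ x ∈ F, g • x ∈ F} :=
    fun g hg h0 => hΓ.exists_smul_mem_of_diffIndex_eq_zero hC hC' hF hun hg h0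
  have hP : ∀ g h, g ∉ P → h ∉ P → g * h ∈ P := by
    intro g h hg hh
    rw [hmemP, mul_smul]
    have h1 := (hswap g hg).compl
    rw [compl_compl, ← Set.smul_set_compl] at h1
    exact ((hswap h hh).smul g).trans h1
  refine surjects_int_or_dihedral P hP (fun g => diffIndex (g • C) C) ?_ ?_ ?_ ?_ hT hker
  · intro g hg h hh
    rw [mul_smul, ← diffIndex_add (AlmostEqual.smul hh g) hg, diffIndex_smul, add_comm]
  · intro g hg t ht
    have ht' : t⁻¹ ∉ P := fun h => ht (by simpa using P.inv_mem h)
    have h1 := hswap _ ht'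
    have hgc : AlmostEqual (g • Cᶜ) Cᶜ := by
      rw [Set.smul_set_compl]
      exact AlmostEqual.compl hg
    have h2 := h1.smul g
    calc diffIndex ((t * g * t⁻¹) • C) C
        = diffIndex (t • g • t⁻¹ • C) (t • t⁻¹ • C) := by rw [smul_inv_smul, mul_smul, mul_smul]
      _ = diffIndex (g • t⁻¹ • C) (t⁻¹ • C) := diffIndex_smul _ _ _
      _ = diffIndex (g • t⁻¹ • C) (g • Cᶜ) + (diffIndex (g • Cᶜ) Cᶜ + diffIndex Cᶜ (t⁻¹ • C)) := by
          rw [diffIndex_add hgc h1.symm, diffIndex_add h2 (hgc.trans h1.symm)]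
      _ = -diffIndex (g • C) C := by
          rw [diffIndex_smul, diffIndex_swap Cᶜ, Set.smul_set_compl, diffIndex_compl]
          ring
  · by_contra! hcon
    have hPT : ∀ g ∈ P, g ∈ {g : G | ∃ x ∈ F, g • x ∈ F} := fun g hg => hker g hg (hcon g hg)
    have hcompact : CompactSpace G := by
      by_cases hall : ∀ g, g ∈ P
      · exact ⟨by convert hT; exact (Set.eq_univ_of_forall fun g => hPT g (hall g)).symm⟩
      · push Not at hall
        obtain ⟨t, ht⟩ := hall
        have ht' : t⁻¹ ∉ P := fun h => ht (by simpa using P.inv_mem h)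
        refine ⟨?_⟩
        convert hT.union (hT.image (continuous_const_mul t))
        refine (Set.eq_univ_of_forall fun g => ?_).symm
        by_cases hg : g ∈ P
        · exact Or.inl (hPT g hg)
        · exact Or.inr ⟨t⁻¹ * g, hPT _ (hP _ _ ht' hg), mul_inv_cancel_left t g⟩
    have := hΓ.finite_of_compactSpace
    exact hC (Set.toFinite C)
  · have hne : (Γ.edgeBoundaryVertices C).Nonempty := by
      obtain ⟨x, hx, -⟩ :=
        SimpleGraph.exists_mem_edgeBoundaryVertices hΓ.connected hC.nonempty hC'.nonempty
      exact ⟨x, hx⟩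
    have hU : ⋂ x ∈ Γ.edgeBoundaryVertices C, {g : G | g • x = x} ∈ 𝓝 (1 : G) :=
      (Filter.biInter_mem hCb).2 fun x _ =>
        (hΓ.isOpen_setOf_smul_eq x x).mem_nhds (one_smul G x)
    filter_upwards [hU] with g hg
    have hgC := hΓ.smul_eq_self_of_forall_edgeBoundaryVertices hne
      (g := g) fun x hx => Set.mem_iInter₂.1 hg x hx
    constructor
    · rw [hmemP, hgC]
      exact AlmostEqual.refl C
    · rw [hgC]
      simp [diffIndex]

end IsCayleyAbelsGraph

end

section

open scoped Pointwise

variable {G : Type u} [Group G] [TopologicalSpace G] [IsTopologicalGroup G]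

theorem hasCocompactDiscreteInfiniteCyclicSubgroup_of_surjects {Q : Type*} [Group Q]
    (h : SurjectsWithCompactOpenKernel G Q) {q : Q} (hq : ∀ n : ℤ, q ^ n = 1 → n = 0) {S : Set Q}
    (hS : S.Finite) (hSq : ∀ p : Q, ∃ n : ℤ, p * q ^ n ∈ S) :
    HasCocompactDiscreteInfiniteCyclicSubgroup G := by
  obtain ⟨f, -, hsurj, hcomp, hopen⟩ := h
  obtain ⟨t, rfl⟩ := hsurj q
  have ht : ∀ n : ℤ, f (t ^ n) = 1 → n = 0 := fun n hn => hq n (by rwa [← map_zpow])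
  have hord : ¬ IsOfFinOrder t := by
    rw [← injective_zpow_iff_not_isOfFinOrder]
    intro m n hmn
    have : t ^ (m - n) = 1 := by
      rw [zpow_sub, mul_inv_eq_one]
      exact hmn
    have := ht (m - n) (by rw [this, map_one])
    omega
  refine ⟨Subgroup.zpowers t, inferInstance, (infinite_zpowers.2 hord).to_subtype, ?_, ?_⟩
  · refine discreteTopology_of_isOpen_singleton_one ?_
    convert hopen.preimage (continuous_subtype_val (p := fun x => x ∈ Subgroup.zpowers t))
    ext ⟨x, hx⟩
    obtain ⟨n, rfl⟩ := Subgroup.mem_zpowers_iff.1 hx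
    simp only [Set.mem_singleton_iff, Set.mem_preimage, SetLike.mem_coe, MonoidHom.mem_ker,
      Subgroup.mk_eq_one]
    constructor
    · intro h
      rw [h, map_one]
    · intro h
      rw [ht n h, zpow_zero]
  · refine ⟨?_⟩
    convert (f.isCompact_preimage_of_isCompact_ker hcomp hS).image
      (QuotientGroup.continuous_mk (N := Subgroup.zpowers t))
    refine (Set.eq_univ_of_forall fun x => ?_).symm
    obtain ⟨g, rfl⟩ := QuotientGroup.mk_surjective x
    obtain ⟨n, hn⟩ := hSq (f g)
    refine ⟨g * t ^ n, by rwa [Set.mem_preimage, map_mul, map_zpow], ?_⟩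
    rw [QuotientGroup.mk_mul_of_mem]
    exact Subgroup.zpow_mem _ (Subgroup.mem_zpowers t) n

theorem hasCocompactDiscreteInfiniteCyclicSubgroup_of_surjects_int_or_dihedral
    (h : SurjectsWithCompactOpenKernel G (Multiplicative ℤ) ∨
      SurjectsWithCompactOpenKernel G (DihedralGroup 0)) :
    HasCocompactDiscreteInfiniteCyclicSubgroup G := by
  rcases h with h | h
  · refine hasCocompactDiscreteInfiniteCyclicSubgroup_of_surjects h
      (q := Multiplicative.ofAdd 1) (fun n hn => ?_) (Set.finite_singleton 1)
      fun p => ⟨-p.toAdd, ?_⟩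
    · rw [← ofAdd_zsmul, ofAdd_eq_one] at hn
      simpa using hn
    · rw [← ofAdd_zsmul, Set.mem_singleton_iff, smul_eq_mul, mul_one, ofAdd_neg, ofAdd_toAdd,
        mul_inv_cancel]
  · have hpow : ∀ n : ℤ, (DihedralGroup.r 1 : DihedralGroup 0) ^ n =
        DihedralGroup.r (Int.cast (R := ZMod 0) n) := fun n => by
      rw [DihedralGroup.r_zpow, one_mul]
    refine hasCocompactDiscreteInfiniteCyclicSubgroup_of_surjects h
      (q := DihedralGroup.r 1) (fun n hn => ?_)
      (Set.toFinite {DihedralGroup.r 0, DihedralGroup.sr 0}) ?_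
    · rw [hpow, DihedralGroup.one_def, DihedralGroup.r.injEq, ZMod.intCast_zmod_eq_zero_iff_dvd,
        Nat.cast_zero, zero_dvd_iff] at hn
      exact hn
    · rintro (k | k) <;> obtain ⟨k, rfl⟩ := ZMod.intCast_surjective k <;> refine ⟨-k, ?_⟩
      · left
        rw [hpow, DihedralGroup.r_mul_r, ← Int.cast_add, add_neg_cancel, Int.cast_zero]
      · right
        rw [hpow, DihedralGroup.sr_mul_r, ← Int.cast_add, add_neg_cancel, Int.cast_zero]
        rfl

namespace IsCayleyAbelsGraph

variable {V : Type v} [MulAction G V] {Γ : SimpleGraph V}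

theorem exists_finite_cover_of_compactSpace_quotient (hΓ : IsCayleyAbelsGraph G Γ)
    (H : Subgroup G) [CompactSpace (G ⧸ H)] :
    ∃ A : Set V, A.Finite ∧ ∀ x : V, ∃ h ∈ H, h • x ∈ A := by
  obtain ⟨v⟩ := hΓ.connected.nonempty
  obtain ⟨A, hA⟩ := (isCompact_univ (X := G ⧸ H)).elim_finite_subcover
    (fun x : V => QuotientGroup.mk '' {g : G | g⁻¹ • v = x})
    (fun x => QuotientGroup.isOpenMap_coe _
      ((hΓ.isOpen_setOf_smul_eq v x).preimage continuous_inv)) (by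
      intro q _
      obtain ⟨g, rfl⟩ := QuotientGroup.mk_surjective q
      exact Set.mem_iUnion.2 ⟨g⁻¹ • v, g, rfl, rfl⟩)
  refine ⟨A, A.finite_toSet, fun y => ?_⟩
  obtain ⟨g, rfl⟩ := hΓ.transitive v y
  obtain ⟨x, hx, g', hg', heq⟩ := Set.mem_iUnion₂.1 (hA (Set.mem_univ (QuotientGroup.mk g⁻¹)))
  refine ⟨g'⁻¹ * g⁻¹, QuotientGroup.eq.1 heq, ?_⟩
  rw [mul_smul, inv_smul_smul, hg']
  exact hx

theorem isTwoEnded_of_hasCocompactDiscreteInfiniteCyclicSubgroup [T2Space G]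
    (hΓ : IsCayleyAbelsGraph G Γ) (h : HasCocompactDiscreteInfiniteCyclicSubgroup G) :
    Γ.IsTwoEnded := by
  obtain ⟨H, hcyc, hinf, hdisc, hcomp⟩ := h
  obtain ⟨⟨t, htH⟩, hgen⟩ := hcyc.exists_generator
  have hH : ∀ h ∈ H, ∃ n : ℤ, t ^ n = h := by
    intro h hh
    obtain ⟨n, hn⟩ := Subgroup.mem_zpowers_iff.1 (hgen ⟨h, hh⟩)
    exact ⟨n, congrArg Subtype.val hn⟩
  have hHz : H = Subgroup.zpowers t :=
    le_antisymm (fun h hh => Subgroup.mem_zpowers_iff.2 (hH h hh)) ((Subgroup.zpowers_le).2 htH)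
  have htinj : Function.Injective fun n : ℤ => t ^ n := by
    rw [injective_zpow_iff_not_isOfFinOrder, ← infinite_zpowers, ← hHz]
    exact Set.infinite_coe_iff.1 hinf
  obtain ⟨A, hA, hAcov⟩ := hΓ.exists_finite_cover_of_compactSpace_quotient H
  have hcov : ∀ x : V, ∃ n : ℤ, t ^ n • x ∈ A := by
    intro x
    obtain ⟨h, hh, hx⟩ := hAcov x
    obtain ⟨n, rfl⟩ := hH h hh
    exact ⟨n, hx⟩
  obtain ⟨v⟩ := hΓ.connected.nonempty
  obtain ⟨-, a, ha⟩ : ∃ n : ℤ, A.Nonempty := by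
    obtain ⟨n, hn⟩ := hcov v
    exact ⟨n, _, hn⟩
  obtain ⟨F, hFfin, hAF, hun⟩ := SimpleGraph.exists_isUnsplit_superset hΓ.connected
    (hA.union (hA.smul_set (a := t) |>.union (hA.biUnion fun x _ => hΓ.locallyFinite x)))
  have hret : {n : ℤ | ∃ x ∈ F, t ^ n • x ∈ F}.Finite := by
    have hclosed : IsClosed (H : Set G) := Subgroup.isClosed_of_discrete
    have hfin : ((H : Set G) ∩ {g : G | ∃ x ∈ F, g • x ∈ F}).Finite :=
      ((hΓ.isCompact_setOf_smul_mem hFfin).inter_left hclosed).finite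
        (IsDiscrete.mono ⟨hdisc⟩ Set.inter_subset_left)
    exact (hfin.preimage htinj.injOn).subset fun n hn => ⟨H.zpow_mem htH n, hn⟩
  obtain ⟨M, hM⟩ := hret.bddAbove
  have hmem : ∀ (n : ℤ) (x : V), x ∈ t ^ n • F ↔ t ^ (-n) • x ∈ F := fun n x => by
    rw [Set.mem_smul_set_iff_inv_smul_mem, zpow_neg]
  refine SimpleGraph.isTwoEnded_of_chain (F := fun n : ℤ => t ^ n • F) (fun n => hFfin.smul_set)
    (fun n => hΓ.isUnsplit_smul hun _) (fun n => ⟨t ^ (n + 1) • a, ?_, ?_⟩) M ?_ ?_ ?_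
  · rw [zpow_add_one, mul_smul]
    exact Set.smul_mem_smul_set (hAF (Or.inr (Or.inl (Set.smul_mem_smul_set ha))))
  · exact Set.smul_mem_smul_set (hAF (Or.inl ha))
  · rintro i j ⟨x, hi, hj⟩
    refine hM ⟨t ^ (-j) • x, (hmem j x).1 hj, ?_⟩
    rw [← mul_smul, ← zpow_add, show j - i + -j = -i by ring]
    exact (hmem i x).1 hi
  · intro x
    obtain ⟨n, hn⟩ := hcov x
    exact ⟨-n, (hmem _ x).2 (by rw [neg_neg]; exact hAF (Or.inl hn))⟩
  · intro x y hxy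
    obtain ⟨n, hn⟩ := hcov x
    refine ⟨-n, (hmem _ x).2 (by rw [neg_neg]; exact hAF (Or.inl hn)),
      (hmem _ y).2 (hAF (Or.inr (Or.inr (Set.mem_biUnion hn ?_))))⟩
    rw [neg_neg]
    exact (hΓ.smul_adj _ _ _).2 hxy

end IsCayleyAbelsGraph

end

section Existence

variable {G : Type u} [Group G] [TopologicalSpace G] [IsTopologicalGroup G]

open scoped Pointwise in
/-- Van Dantzig's theorem. -/
theorem exists_isCompact_isOpen_subgroup [TotallyDisconnectedSpace G] [LocallyCompactSpace G] :
    ∃ U : Subgroup G, IsOpen (U : Set G) ∧ IsCompact (U : Set G) := by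
  obtain ⟨K, hK, hK1⟩ := exists_compact_mem_nhds (1 : G)
  obtain ⟨W, hW, hW1, hWK⟩ :=
    (loc_compact_Haus_tot_disc_of_zero_dim (H := G)).mem_nhds_iff.1 hK1
  have hWc : IsCompact W := hK.of_isClosed_subset hW.1 hWK
  obtain ⟨T, hT, hWT⟩ := compact_open_separated_mul_right hWc hW.2 subset_rfl
  let U : Subgroup G :=
    { carrier := {g | ∀ w, w * g ∈ W ↔ w ∈ W}
      one_mem' := by simp
      mul_mem' := fun {g h} hg hh w => by rw [← mul_assoc, hh, hg]
      inv_mem' := fun {g} hg w => by rw [← hg, inv_mul_cancel_right] }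
  have hUopen : IsOpen (U : Set G) := by
    refine Subgroup.isOpen_of_mem_nhds U (g := 1) ?_
    filter_upwards [hT, inv_mem_nhds_one G hT] with g hg hg'
    intro w
    refine ⟨fun h => ?_, fun h => hWT (Set.mul_mem_mul h hg)⟩
    have := hWT (Set.mul_mem_mul h hg')
    rwa [mul_inv_cancel_right] at this
  refine ⟨U, hUopen, hWc.of_isClosed_subset (Subgroup.isClosed_of_isOpen _ hUopen) ?_⟩
  intro g hg
  have := (hg 1).2 hW1
  rwa [one_mul] at this

/-- The graph on the left cosets of `U` in which `gU` is joined to `gsU` for `s ∈ S`. -/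
def cosetGraph (U : Subgroup G) (S : Set G) : SimpleGraph (G ⧸ U) :=
  SimpleGraph.fromRel fun x y =>
    ∃ g : G, ∃ s ∈ S, x = QuotientGroup.mk g ∧ y = QuotientGroup.mk (g * s)

theorem isCayleyAbelsGraph_cosetGraph {U : Subgroup G} (hU : IsOpen (U : Set G))
    (hU' : IsCompact (U : Set G)) {S : Set G} (hS : IsCompact S) (hgen : Subgroup.closure S = ⊤) :
    IsCayleyAbelsGraph G (cosetGraph U S) := by
  have hdisc : DiscreteTopology (G ⧸ U) := QuotientGroup.discreteTopology hU
  have hsmul : ∀ g h : G, g • (QuotientGroup.mk h : G ⧸ U) = QuotientGroup.mk (g * h) :=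
    fun _ _ => rfl
  have hstab : ∀ g : G, (MulAction.stabilizer G (QuotientGroup.mk g : G ⧸ U) : Set G) =
      (fun h => g * h * g⁻¹) '' (U : Set G) := by
    intro g
    ext h
    simp only [SetLike.mem_coe, MulAction.mem_stabilizer_iff, hsmul, Set.mem_image]
    rw [eq_comm, QuotientGroup.eq]
    constructor
    · intro hh
      exact ⟨_, hh, by group⟩
    · rintro ⟨k, hk, rfl⟩
      rwa [show g⁻¹ * (g * k * g⁻¹ * g) = k by group]
  have hconj : ∀ g : G, Continuous fun h => g * h * g⁻¹ := fun g => by fun_prop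
  have hadj : ∀ g h : G, (cosetGraph U S).Adj (QuotientGroup.mk g) (QuotientGroup.mk h) ↔
      (QuotientGroup.mk g : G ⧸ U) ≠ QuotientGroup.mk h ∧
      ((∃ u ∈ U, ∃ s ∈ S, (QuotientGroup.mk h : G ⧸ U) = QuotientGroup.mk (g * u * s)) ∨
        ∃ u ∈ U, ∃ s ∈ S, (QuotientGroup.mk g : G ⧸ U) = QuotientGroup.mk (h * u * s)) := by
    have key : ∀ g h : G, (∃ k : G, ∃ s ∈ S, (QuotientGroup.mk g : G ⧸ U) = QuotientGroup.mk k ∧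
        (QuotientGroup.mk h : G ⧸ U) = QuotientGroup.mk (k * s)) ↔
        ∃ u ∈ U, ∃ s ∈ S, (QuotientGroup.mk h : G ⧸ U) = QuotientGroup.mk (g * u * s) := by
      intro g h
      constructor
      · rintro ⟨k, s, hs, h1, h2⟩
        exact ⟨g⁻¹ * k, QuotientGroup.eq.1 h1, s, hs, by rwa [mul_inv_cancel_left]⟩
      · rintro ⟨u, hu, s, hs, h⟩
        exact ⟨g * u, s, hs, (QuotientGroup.mk_mul_of_mem g hu).symm, h⟩
    intro g h
    rw [cosetGraph, SimpleGraph.fromRel_adj, key, key]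
  refine ⟨⟨?_⟩, ?_, ?_, ?_, ?_, ?_⟩
  · have hstep : ∀ g : G, ∀ s ∈ S, (cosetGraph U S).Reachable (QuotientGroup.mk g)
        (QuotientGroup.mk (g * s)) := by
      intro g s hs
      by_cases h : (QuotientGroup.mk g : G ⧸ U) = QuotientGroup.mk (g * s)
      · rw [← h]
      · exact ((hadj g (g * s)).2
          ⟨h, Or.inl ⟨1, U.one_mem, s, hs, by rw [mul_one]⟩⟩).reachable
    have hone : ∀ g : G, (cosetGraph U S).Reachable (QuotientGroup.mk 1) (QuotientGroup.mk g) := by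
      intro g
      have hg : g ∈ Subgroup.closure S := hgen ▸ Subgroup.mem_top g
      induction hg using Subgroup.closure_induction_right with
      | one => exact SimpleGraph.Reachable.refl _
      | mul_right x _ y hy ih => exact ih.trans (hstep x y hy)
      | mul_inv_cancel x _ y hy ih =>
        refine ih.trans ?_
        have := hstep (x * y⁻¹) y hy
        rw [inv_mul_cancel_right] at this
        exact this.symm
    intro x y
    obtain ⟨g, rfl⟩ := QuotientGroup.mk_surjective x
    obtain ⟨h, rfl⟩ := QuotientGroup.mk_surjective y
    exact (hone g).symm.trans (hone h)
  · intro x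
    obtain ⟨g, rfl⟩ := QuotientGroup.mk_surjective x
    have hfin : ∀ S' : Set G, IsCompact S' →
        ((fun p : G × G => (QuotientGroup.mk (g * p.1 * p.2) : G ⧸ U)) ''
          ((U : Set G) ×ˢ S')).Finite :=
      fun S' hS' => ((hU'.prod hS').image (QuotientGroup.continuous_mk.comp
        (by fun_prop : Continuous fun p : G × G => g * p.1 * p.2))).finite_of_discrete
    refine ((hfin S hS).union (hfin S⁻¹ hS.inv)).subset ?_
    intro y hy
    obtain ⟨h, rfl⟩ := QuotientGroup.mk_surjective y
    rcases ((hadj g h).1 hy).2 with ⟨u, hu, s, hs, heq⟩ | ⟨u, hu, s, hs, heq⟩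
    · exact Or.inl ⟨(u, s), ⟨hu, hs⟩, heq.symm⟩
    · refine Or.inr ⟨(g⁻¹ * (h * u * s), s⁻¹), ⟨QuotientGroup.eq.1 heq, by simpa using hs⟩, ?_⟩
      change (QuotientGroup.mk (g * (g⁻¹ * (h * u * s)) * s⁻¹) : G ⧸ U) = _
      rw [mul_inv_cancel_left, mul_inv_cancel_right, QuotientGroup.mk_mul_of_mem _ hu]
  · intro k x y
    obtain ⟨g, rfl⟩ := QuotientGroup.mk_surjective x
    obtain ⟨h, rfl⟩ := QuotientGroup.mk_surjective y
    have hinj : ∀ a b : G, (QuotientGroup.mk (k * a) : G ⧸ U) = QuotientGroup.mk (k * b) ↔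
        (QuotientGroup.mk a : G ⧸ U) = QuotientGroup.mk b := fun a b => by
      rw [← hsmul, ← hsmul, smul_left_cancel_iff]
    rw [hsmul, hsmul, hadj, hadj]
    simp only [mul_assoc, hinj, ne_eq]
  · intro x y
    obtain ⟨g, rfl⟩ := QuotientGroup.mk_surjective x
    obtain ⟨h, rfl⟩ := QuotientGroup.mk_surjective y
    exact ⟨h * g⁻¹, by rw [hsmul, inv_mul_cancel_right]⟩
  · intro x
    obtain ⟨g, rfl⟩ := QuotientGroup.mk_surjective x
    rw [hstab]
    exact ((Homeomorph.mulRight g⁻¹).isOpenMap.comp (Homeomorph.mulLeft g).isOpenMap) _ hU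
  · intro x
    obtain ⟨g, rfl⟩ := QuotientGroup.mk_surjective x
    rw [hstab]
    exact hU'.image (hconj g)

theorem exists_isCayleyAbelsGraph [TotallyDisconnectedSpace G] [LocallyCompactSpace G]
    (hG : IsCompactlyGeneratedGroup G) :
    ∃ (V : Type u) (_ : MulAction G V) (Γ : SimpleGraph V), IsCayleyAbelsGraph G Γ := by
  obtain ⟨U, hU, hU'⟩ := exists_isCompact_isOpen_subgroup (G := G)
  obtain ⟨S, hS, hgen⟩ := hG
  exact ⟨G ⧸ U, inferInstance, cosetGraph U S, isCayleyAbelsGraph_cosetGraph hU hU' hS hgen⟩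

end Existence

section MinimalDegree

/-- The two-way infinite path. -/
def intPathGraph : SimpleGraph (ULift.{u} ℤ) where
  Adj x y := x.down = y.down + 1 ∨ y.down = x.down + 1
  symm := ⟨fun _ _ h => h.symm⟩
  loopless := ⟨fun x h => by omega⟩

theorem intPathGraph_connected : (intPathGraph.{u}).Connected := by
  refine ⟨fun x y => ?_⟩
  have key : ∀ k : ℤ, intPathGraph.Reachable (⟨0⟩ : ULift.{u} ℤ) ⟨k⟩ := by
    intro k
    induction k with
    | zero => exact SimpleGraph.Reachable.refl _
    | succ k ih => exact ih.trans (SimpleGraph.Adj.reachable (Or.inr rfl))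
    | pred k ih => exact ih.trans (SimpleGraph.Adj.reachable (Or.inl (by simp)))
  exact (key x.down).symm.trans (key y.down)

theorem neighborSet_intPathGraph (x : ULift.{u} ℤ) :
    intPathGraph.neighborSet x = {⟨x.down - 1⟩, ⟨x.down + 1⟩} := by
  ext y
  rw [SimpleGraph.mem_neighborSet, Set.mem_insert_iff, Set.mem_singleton_iff, ULift.ext_iff,
    ULift.ext_iff]
  change (x.down = y.down + 1 ∨ y.down = x.down + 1) ↔ _
  constructor <;> rintro (h | h)
  · left; change y.down = x.down - 1; omega
  · right; exact h
  · left; change y.down = x.down - 1 at h; omega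
  · right; exact h

variable {G : Type u} [Group G] [TopologicalSpace G]

theorem IsCayleyAbelsGraph.finite_of_ncard_neighborSet_le_one {V : Type v} [MulAction G V]
    {Γ : SimpleGraph V} (hΓ : IsCayleyAbelsGraph G Γ) {d : ℕ} (hd : d ≤ 1)
    (h : ∀ x, (Γ.neighborSet x).ncard = d) : Finite V := by
  obtain ⟨v⟩ := hΓ.connected.nonempty
  have hle : ∀ x y z, Γ.Adj x y → Γ.Adj x z → y = z := by
    intro x y z hy hz
    exact (Set.ncard_le_one (hΓ.locallyFinite x)).1 ((h x).trans_le hd) y hy z hz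
  have hempty : Γ.edgeBoundaryVertices (insert v (Γ.neighborSet v)) = ∅ := by
    have key : ∀ x y, Γ.Adj x y → x ∈ insert v (Γ.neighborSet v) →
        y ∈ insert v (Γ.neighborSet v) := by
      rintro x y hxy (rfl | hx)
      · exact Or.inr hxy
      · exact Or.inl (hle x y v hxy hx.symm)
    refine Set.eq_empty_of_forall_notMem ?_
    rintro x ⟨y, hxy, hne⟩
    exact hne ⟨key x y hxy, key y x hxy.symm⟩
  have huniv := SimpleGraph.eq_univ_of_edgeBoundaryVertices_eq_empty hΓ.connected
    (Set.insert_nonempty _ _) hempty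
  exact Set.finite_univ_iff.1 (huniv ▸ (hΓ.locallyFinite v).insert v)

theorem zero_mem_cayleyAbelsDegrees [CompactSpace G] : 0 ∈ cayleyAbelsDegrees G := by
  let act : MulAction G PUnit.{u + 1} :=
    { smul := fun _ x => x, one_smul := fun _ => rfl, mul_smul := fun _ _ _ => rfl }
  have hstab : ∀ x : PUnit.{u + 1}, (MulAction.stabilizer G x : Set G) = Set.univ :=
    fun x => Set.eq_univ_of_forall fun g => rfl
  refine ⟨PUnit.{u + 1}, act, ⊥, ⟨⟨fun x y => ?_⟩, fun x => Set.toFinite _, fun _ _ _ => Iff.rfl,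
    fun x y => ⟨1, rfl⟩, fun x => ?_, fun x => ?_⟩, fun x => ?_⟩
  · exact SimpleGraph.Reachable.refl x
  · rw [hstab]
    exact isOpen_univ
  · rw [hstab]
    exact isCompact_univ
  · rw [Set.ncard_eq_zero]
    ext y
    simp

variable [IsTopologicalGroup G]

theorem two_mem_cayleyAbelsDegrees_of_surjects {Q : Type*} [Group Q]
    (h : SurjectsWithCompactOpenKernel G Q) (ρ : Q →* Equiv.Perm ℤ)
    (hadj : ∀ q x, ρ q (x + 1) = ρ q x + 1 ∨ ρ q x = ρ q (x + 1) + 1)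
    (htrans : ∀ x, ∃ q, ρ q 0 = x) (hfin : ∀ x, {q | ρ q x = x}.Finite) :
    ¬ CompactSpace G ∧ 2 ∈ cayleyAbelsDegrees G := by
  obtain ⟨f, -, hsurj, hcomp, hopen⟩ := h
  let act : MulAction G (ULift.{u} ℤ) :=
    { smul := fun g x => ⟨ρ (f g) x.down⟩
      one_smul := fun x => ULift.ext _ _ (by
        change ρ (f 1) x.down = x.down
        rw [map_one, map_one]
        rfl)
      mul_smul := fun g h x => ULift.ext _ _ (by
        change ρ (f (g * h)) x.down = ρ (f g) (ρ (f h) x.down)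
        rw [map_mul, map_mul]
        rfl) }
  have hsmul : ∀ (g : G) (x : ULift.{u} ℤ), g • x = ⟨ρ (f g) x.down⟩ := fun _ _ => rfl
  have hadj' : ∀ (g : G) (x y : ULift.{u} ℤ), intPathGraph.Adj x y →
      intPathGraph.Adj (g • x) (g • y) := by
    rintro g ⟨x⟩ ⟨y⟩ h
    have h : x = y + 1 ∨ y = x + 1 := h
    change ρ (f g) x = ρ (f g) y + 1 ∨ ρ (f g) y = ρ (f g) x + 1
    rcases h with rfl | rfl
    · exact hadj _ _
    · exact (hadj _ _).symm
  have hCA : IsCayleyAbelsGraph G (intPathGraph.{u}) := by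
    refine ⟨intPathGraph_connected, fun x => ?_, fun g x y => ⟨fun h => ?_, hadj' g x y⟩, ?_, ?_,
      ?_⟩
    · rw [neighborSet_intPathGraph]
      exact Set.toFinite _
    · have := hadj' g⁻¹ _ _ h
      rwa [inv_smul_smul, inv_smul_smul] at this
    · have h0 : ∀ x : ULift.{u} ℤ, ∃ g : G, g • (⟨0⟩ : ULift.{u} ℤ) = x := by
        rintro ⟨x⟩
        obtain ⟨q, hq⟩ := htrans x
        obtain ⟨g, rfl⟩ := hsurj q
        exact ⟨g, by rw [hsmul, hq]⟩
      intro x y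
      obtain ⟨g, rfl⟩ := h0 x
      obtain ⟨h, rfl⟩ := h0 y
      exact ⟨h * g⁻¹, by rw [mul_smul, inv_smul_smul]⟩
    · intro x
      refine Subgroup.isOpen_mono (H₁ := f.ker) (fun g hg => ?_) hopen
      rw [MulAction.mem_stabilizer_iff, hsmul, MonoidHom.mem_ker.1 hg, map_one]
      rfl
    · intro x
      convert f.isCompact_preimage_of_isCompact_ker hcomp (hfin x.down)
      ext g
      simp [MulAction.mem_stabilizer_iff, hsmul, ULift.ext_iff]
  refine ⟨fun hc => ?_, ULift.{u} ℤ, act, intPathGraph, hCA, fun x => ?_⟩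
  · have := hCA.finite_of_compactSpace
    exact not_finite (ULift.{u} ℤ)
  · rw [neighborSet_intPathGraph, Set.ncard_pair]
    intro h
    have := congrArg ULift.down h
    simp only at this
    omega

theorem zmod_zero_cast_intCast (k : ℤ) : (ZMod.cast (Int.cast (R := ZMod 0) k) : ℤ) = k :=
  Int.cast_id

/-- The action of the infinite dihedral group on the integers. -/
def dihedralIntPerm : DihedralGroup 0 →* Equiv.Perm ℤ :=
  MonoidHom.toHomPerm
    { toFun := fun q x => match q with
        | DihedralGroup.r i => x + (ZMod.cast i : ℤ)
        | DihedralGroup.sr i => -x - (ZMod.cast i : ℤ)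
      map_one' := by
        funext x
        change x + (ZMod.cast (0 : ZMod 0) : ℤ) = x
        rw [ZMod.cast_zero, add_zero]
      map_mul' := by
        rintro (i | i) (j | j) <;> obtain ⟨i, rfl⟩ := ZMod.intCast_surjective i <;>
          obtain ⟨j, rfl⟩ := ZMod.intCast_surjective j <;> funext x
        · change x + (ZMod.cast (Int.cast (R := ZMod 0) i + Int.cast (R := ZMod 0) j) : ℤ) =
            x + ZMod.cast (Int.cast (R := ZMod 0) j) + ZMod.cast (Int.cast (R := ZMod 0) i)
          rw [← Int.cast_add]
          simp only [zmod_zero_cast_intCast]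
          ring
        · change -x - (ZMod.cast (Int.cast (R := ZMod 0) j - Int.cast (R := ZMod 0) i) : ℤ) =
            -x - ZMod.cast (Int.cast (R := ZMod 0) j) + ZMod.cast (Int.cast (R := ZMod 0) i)
          rw [← Int.cast_sub]
          simp only [zmod_zero_cast_intCast]
          ring
        · change -x - (ZMod.cast (Int.cast (R := ZMod 0) i + Int.cast (R := ZMod 0) j) : ℤ) =
            -(x + ZMod.cast (Int.cast (R := ZMod 0) j)) - ZMod.cast (Int.cast (R := ZMod 0) i)
          rw [← Int.cast_add]
          simp only [zmod_zero_cast_intCast]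
          ring
        · change x + (ZMod.cast (Int.cast (R := ZMod 0) j - Int.cast (R := ZMod 0) i) : ℤ) =
            -(-x - ZMod.cast (Int.cast (R := ZMod 0) j)) - ZMod.cast (Int.cast (R := ZMod 0) i)
          rw [← Int.cast_sub]
          simp only [zmod_zero_cast_intCast]
          ring }

theorem dihedralIntPerm_r (k x : ℤ) :
    dihedralIntPerm (DihedralGroup.r (Int.cast (R := ZMod 0) k)) x = x + k :=
  congrArg (x + ·) (zmod_zero_cast_intCast k)

theorem dihedralIntPerm_sr (k x : ℤ) :
    dihedralIntPerm (DihedralGroup.sr (Int.cast (R := ZMod 0) k)) x = -x - k :=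
  congrArg (-x - ·) (zmod_zero_cast_intCast k)

/-- The translation action of `ℤ`, written multiplicatively, on itself. -/
def translationIntPerm : Multiplicative ℤ →* Equiv.Perm ℤ :=
  MonoidHom.toHomPerm
    { toFun := fun k x => k.toAdd + x
      map_one' := by
        funext x
        exact zero_add x
      map_mul' := fun k l => by
        funext x
        exact add_assoc k.toAdd l.toAdd x }

theorem not_compactSpace_and_two_mem_cayleyAbelsDegrees
    (h : SurjectsWithCompactOpenKernel G (Multiplicative ℤ) ∨
      SurjectsWithCompactOpenKernel G (DihedralGroup 0)) :
    ¬ CompactSpace G ∧ 2 ∈ cayleyAbelsDegrees G := by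
  rcases h with h | h
  · have hρ : ∀ k x, translationIntPerm k x = k.toAdd + x := fun _ _ => rfl
    refine two_mem_cayleyAbelsDegrees_of_surjects h translationIntPerm (fun k x => ?_)
      (fun x => ⟨Multiplicative.ofAdd x, ?_⟩) fun x => ?_
    · left
      rw [hρ, hρ, add_assoc]
    · rw [hρ, toAdd_ofAdd, add_zero]
    · refine (Set.finite_singleton 1).subset fun k hk => ?_
      have hk : k.toAdd + x = x := hk
      exact toAdd_eq_zero.1 (by omega)
  · refine two_mem_cayleyAbelsDegrees_of_surjects h dihedralIntPerm ?_
      (fun x => ⟨DihedralGroup.r (Int.cast (R := ZMod 0) x), ?_⟩) fun x => ?_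
    · rintro (k | k) x <;> obtain ⟨k, rfl⟩ := ZMod.intCast_surjective k
      · left
        rw [dihedralIntPerm_r, dihedralIntPerm_r]
        ring
      · right
        rw [dihedralIntPerm_sr, dihedralIntPerm_sr]
        ring
    · rw [dihedralIntPerm_r, zero_add]
    · refine (Set.toFinite {DihedralGroup.r (Int.cast (R := ZMod 0) 0),
        DihedralGroup.sr (Int.cast (R := ZMod 0) (-2 * x))}).subset ?_
      rintro (k | k) hk <;> obtain ⟨k, rfl⟩ := ZMod.intCast_surjective k
      · left
        have hk := (dihedralIntPerm_r k x).symm.trans hk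
        rw [show k = 0 by omega]
      · right
        have hk := (dihedralIntPerm_sr k x).symm.trans hk
        rw [Set.mem_singleton_iff, show k = -2 * x by omega]

theorem minimalDegree_eq_two (hG : ¬ CompactSpace G) (h : 2 ∈ cayleyAbelsDegrees G) :
    minimalDegree G = 2 := by
  refine le_antisymm (Nat.sInf_le h) (le_csInf ⟨2, h⟩ ?_)
  rintro d ⟨V, _, Γ, hΓ, hd⟩
  by_contra! hlt
  have := hΓ.finite_of_ncard_neighborSet_le_one (by omega) hd
  exact hG hΓ.compactSpace_of_finite

theorem exists_isTwoEnded_of_minimalDegree_eq_two (h : minimalDegree G = 2) :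
    ∃ (V : Type u) (_ : MulAction G V) (Γ : SimpleGraph V),
      IsCayleyAbelsGraph G Γ ∧ Γ.IsTwoEnded := by
  have hne : (cayleyAbelsDegrees G).Nonempty := by
    by_contra hempty
    rw [Set.not_nonempty_iff_eq_empty] at hempty
    rw [minimalDegree, hempty, Nat.sInf_empty] at h
    omega
  have hmem : minimalDegree G ∈ cayleyAbelsDegrees G := Nat.sInf_mem hne
  rw [h] at hmem
  obtain ⟨V, act, Γ, hΓ, h2⟩ := hmem
  refine ⟨V, act, Γ, hΓ, ?_⟩
  rcases finite_or_infinite V with hV | hV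
  · have := hΓ.compactSpace_of_finite
    have h0 : minimalDegree G ≤ 0 := Nat.sInf_le zero_mem_cayleyAbelsDegrees
    omega
  · exact SimpleGraph.isTwoEnded_of_ncard_neighborSet_eq_two hΓ.connected h2

end MinimalDegree

/-- For the infinite dihedral group we use `DihedralGroup 0`, whose rotations are indexed by
`ZMod 0 = ℤ`. -/
theorem mainTheorem5 (G : Type u) [Group G] [TopologicalSpace G] [IsTopologicalGroup G]
    [TotallyDisconnectedSpace G] [LocallyCompactSpace G] (hG : IsCompactlyGeneratedGroup G) :
    List.TFAE [
      minimalDegree G = 2,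
      ∃ (V : Type u) (_ : MulAction G V) (Γ : SimpleGraph V),
        IsCayleyAbelsGraph G Γ ∧ Nat.card (GraphEnd Γ) = 2,
      ∀ (V : Type u) (_ : MulAction G V) (Γ : SimpleGraph V),
        IsCayleyAbelsGraph G Γ → Nat.card (GraphEnd Γ) = 2,
      SurjectsWithCompactOpenKernel G (Multiplicative ℤ) ∨
        SurjectsWithCompactOpenKernel G (DihedralGroup 0),
      HasCocompactDiscreteInfiniteCyclicSubgroup G] := by
  tfae_have 1 → 2 := by
    intro h
    obtain ⟨V, act, Γ, hΓ, hends⟩ := exists_isTwoEnded_of_minimalDegree_eq_two h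
    exact ⟨V, act, Γ, hΓ, hends.card_graphEnd hΓ.connected hΓ.locallyFinite⟩
  tfae_have 2 → 4 := by
    rintro ⟨V, act, Γ, hΓ, hends⟩
    exact hΓ.surjects_of_isTwoEnded
      (SimpleGraph.isTwoEnded_of_card_graphEnd hΓ.connected hΓ.locallyFinite hends)
  tfae_have 4 → 1 := fun h =>
    minimalDegree_eq_two (not_compactSpace_and_two_mem_cayleyAbelsDegrees h).1
      (not_compactSpace_and_two_mem_cayleyAbelsDegrees h).2
  tfae_have 4 → 5 := hasCocompactDiscreteInfiniteCyclicSubgroup_of_surjects_int_or_dihedral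
  tfae_have 5 → 3 := fun h V _ Γ hΓ =>
    (hΓ.isTwoEnded_of_hasCocompactDiscreteInfiniteCyclicSubgroup h).card_graphEnd hΓ.connected
      hΓ.locallyFinite
  tfae_have 3 → 2 := by
    intro h
    obtain ⟨V, act, Γ, hΓ⟩ := exists_isCayleyAbelsGraph hG
    exact ⟨V, act, Γ, hΓ, h V act Γ hΓ⟩
  tfae_finish
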